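/- Let $r\ge 1$ be an integer and let $\lambda_1,\dots,\lambda_r,\alpha_1,\dots,\alpha_r\in[0,1)$ be real numbers. On the open set $$U_r=\{(s_1,\dots,s_r)\in\mathbb C^r : \operatorname{Re}(s_1+\cdots+s_i)>i \text{ for all } 1\le i\le r\}$$ the multiple Lerch zeta function of depth $r$ is defined by the absolutely convergent series $$L_r(s_1,\dots,s_r)=\sum_{n_1>\cdots>n_r>0}\frac{e(\lambda_1n_1)\cdots e(\lambda_rn_r)}{(n_1+\alpha_1)^{s_1}\cdots(n_r+\alpha_r)^{s_r}},\qquad e(a)=e^{2\pi\sqrt{-1}\,a}.$$ For $1\le i\le r$ and integers $k\ge 0$ put $\mu_i=\lambda_1+\cdots+\lambda_i$ and $H_{i,k}=\{s\in\mathbb C^r : s_1+\cdots+s_i=i-k\}$. Let $i_1<\cdots<i_m$ be all the indices $i\in\{1,\dots,r\}$ with $\mu_i\in\mathbb Z$ (possibly $m=0$). Then $L_r$ continues to a meromorphic function on $\mathbb C^r$, holomorphic outside the hyperplanes listed below and with at most simple poles along them; that is, near every point of $\mathbb C^r$ the product of the function with the affine forms $s_1+\cdots+s_i-i+k$ of those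 (finitely many) listed hyperplanes $H_{i,k}$ that pass through the point is holomorphic. - If $m\ge1$ and $i_1=1$, the hyperplanes are $H_{1,0}$ and $H_{i_j,k}$ for all $2\le j\le m$ and $k\ge 0$ with $i_j-k\le j$. - Otherwise (that is, if $m=0$ or $i_1\ne1$), the hyperplanes are $H_{i_j,k}$ for all $1\le j\le m$ and $k\ge0$ with $i_j-k\le j$; in particular $L_r$ continues to an entire function if $m=0$. -/

import Mathlib

open Filter Topology

noncomputable section

namespace MultipleLerch

/-- The partial sum `v_1 + ⋯ + v_l` of a tuple `v = (v_1, …, v_r)`; the entry `v_{j+1}` of the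
tuple is `v j` for `j : Fin r`. -/
def partialSum {M : Type*} [AddCommMonoid M] {r : ℕ} (v : Fin r → M) (l : ℕ) : M :=
  ∑ j ∈ Finset.univ.filter (fun j : Fin r => (j : ℕ) < l), v j

/-- `e(a) = exp(2 π i a)`. -/
def e (a : ℝ) : ℂ := Complex.exp (2 * Real.pi * Complex.I * a)

/-- The index set of the series: `r`-tuples of natural numbers with `n_1 > ⋯ > n_r > 0`. -/
def Index (r : ℕ) : Type := {n : Fin r → ℕ // StrictAnti n ∧ ∀ j, 0 < n j}

/-- The general term of the multiple Lerch series. -/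
def lerchTerm {r : ℕ} (lam α : Fin r → ℝ) (s : Fin r → ℂ) (n : Index r) : ℂ :=
  (∏ j, e (lam j * n.1 j)) / ∏ j, ((n.1 j : ℂ) + (α j : ℂ)) ^ s j

/-- The multiple Lerch series (meaningful where the series converges absolutely). -/
def lerchL {r : ℕ} (lam α : Fin r → ℝ) (s : Fin r → ℂ) : ℂ :=
  ∑' n : Index r, lerchTerm lam α s n

/-- The open set `U_r`: `Re (s_1 + ⋯ + s_l) > l` for all `1 ≤ l ≤ r`. -/
def U (r : ℕ) : Set (Fin r → ℂ) :=
  {s | ∀ l : ℕ, 1 ≤ l → l ≤ r → (l : ℝ) < (partialSum s l).re}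

/-- The affine form `s_1 + ⋯ + s_l - (l - k)`. -/
def hyperplaneForm {r : ℕ} (l k : ℕ) (s : Fin r → ℂ) : ℂ :=
  partialSum s l - ((l : ℂ) - (k : ℂ))

/-- The hyperplane `H_{l,k}`: `s_1 + ⋯ + s_l = l - k`. -/
def H (r l k : ℕ) : Set (Fin r → ℂ) := {s | partialSum s l = (l : ℂ) - (k : ℂ)}

/-- Holomorphy at a point of `ℂ^r`: complex (Fréchet) differentiability on a neighbourhood. -/
def HolomorphicAt {r : ℕ} (f : (Fin r → ℂ) → ℂ) (p : Fin r → ℂ) : Prop :=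
  ∀ᶠ s in 𝓝 p, DifferentiableAt ℂ f s

/-- `F` represents a meromorphic function on `ℂ^r`: near every point it is a quotient `g / h` of
holomorphic functions, where `h` does not vanish identically near the point. The values of `F` at
points where every such denominator vanishes carry no information. -/
def IsMeromorphic {r : ℕ} (F : (Fin r → ℂ) → ℂ) : Prop :=
  ∀ p : Fin r → ℂ, ∃ g h : (Fin r → ℂ) → ℂ,
    HolomorphicAt g p ∧ HolomorphicAt h p ∧ (¬ ∀ᶠ s in 𝓝 p, h s = 0) ∧
      ∀ᶠ s in 𝓝 p, h s ≠ 0 → F s = g s / h s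

/-- `F` has no singularities outside the hyperplanes `H_{l,k}` with `(l, k) ∈ P`, and has at most
simple poles along these: only finitely many of them pass through a given point `p`, and after
multiplication by their affine forms (each to the first power) `F` extends holomorphically to a
neighbourhood of `p`. To be used for sets `P` of pairs `(l, k)` with `1 ≤ l ≤ r`, so that
distinct pairs give distinct hyperplanes. -/
def HasAtMostSimplePolesAlong {r : ℕ} (F : (Fin r → ℂ) → ℂ) (P : Set (ℕ × ℕ)) : Prop :=
  (∀ p : Fin r → ℂ, (∀ q ∈ P, p ∉ H r q.1 q.2) → HolomorphicAt F p) ∧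
  ∀ p : Fin r → ℂ, ∃ T : Finset (ℕ × ℕ), (∀ q, q ∈ T ↔ q ∈ P ∧ p ∈ H r q.1 q.2) ∧
    ∃ G : (Fin r → ℂ) → ℂ, HolomorphicAt G p ∧
      ∀ᶠ s in 𝓝 p, (∀ q ∈ P, s ∉ H r q.1 q.2) →
        F s * ∏ q ∈ T, hyperplaneForm q.1 q.2 s = G s

end MultipleLerch

end

/-!
# Meromorphic continuation of the multiple Lerch zeta function

The series is summed one variable at a time, starting from the largest, `n_1`. Write `V_l(n, s)` for
the sum over `n_1 > ⋯ > n_l > n`, put `μ_l = λ_1 + ⋯ + λ_l`, `w_l = s_1 + ⋯ + s_l`, and let `c_l` be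
the number of `i ≤ l` with `μ_i ∈ ℤ`. The point is that, up to an explicit entire factor `D_l(s)`,
`V_l(n, s) = e(μ_l) ^ n * n ^ (c_l - w_l) * G_l(n, s)`, where `G_l` is a *symbol* (`IsSymbol`): it is
entire in `s`, and on every ball in `ℂ ^ r` it has an expansion in powers of `1 / n`, with entire
coefficients, to every order. So `G_l(n, s)` continues `V_l(n, s)` to all `s`, and the expansion
contains what is needed for the next summation (`IsInnerSumSymbol.succ`).

A summation is an inversion of a difference operator. To sum `ζ ^ m * m ^ (-W) * h(m)` over `m ≥ n`
one looks for a symbol `q` for which `v(n) = ζ ^ n * n ^ (δ - W) * q(n)` satisfies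
`v(n) - v(n + 1) = ζ ^ n * n ^ (-W) * h(n)` up to a relative error `O(n ^ (-K))` (`IsSolvable`).
The first part telescopes, and the error contributes a series that converges once `K` is large; by
the identity theorem the continuations obtained on different balls agree (`exists_isSymbol_tail`).
By the binomial expansion (`exists_stepOp_expansion`) the difference equation is solved term by term:

* if `ζ ≠ 1`, with `δ = 0` and division by `1 - ζ` only (`IsSymbol.isSolvable`), so no pole arises;
* if `ζ = 1`, with `δ = 1` and division by `W - 1, W, W + 1, …`, so that `1 / Γ(W - 1)` has to be
  supplied as a factor (`IsSymbol.isSolvable_inv_Gamma_mul`). For a pure power of `m + α` the factor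
  `W - 1` suffices, since the binomial coefficients provide the other ones
  (`isSolvable_shiftedPow`); this is why `H_{1,0}` is the only hyperplane with first index `1`.

For the summation over `n_l` one has `W = w_l - c_{l-1}`, hence `W - 1 = w_l - c_l` when `μ_l ∈ ℤ`.
Therefore `D_r(s)`, the product of the factors `1 / Γ(w_l - c_l)` over `l` with `μ_l ∈ ℤ` (with `s_1 - 1`
in place of the one for `l = 1`), makes the whole series entire. Its zeros are simple and lie
along the hyperplanes `w_l = c_l - k'`, `k' ≥ 0`, which are exactly the listed ones
(`exists_polarFactor_eq`).
-/

namespace MultipleLerch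

/-! ### Holomorphic functions on complex normed spaces -/

section SeveralVariables

variable {E : Type*} [NormedAddCommGroup E] [NormedSpace ℂ E]

/-- The Weierstrass theorem for series of holomorphic functions on a complex normed space; the
derivatives are controlled by Cauchy's estimate (in the form of the Schwarz lemma). -/
theorem differentiableOn_tsum_of_norm_le {f : ℕ → E → ℂ} {u : ℕ → ℝ} (hu : Summable u)
    {U : Set E} (hU : IsOpen U) (hf : ∀ n, DifferentiableOn ℂ (f n) U)
    (hb : ∀ n, ∀ x ∈ U, ‖f n x‖ ≤ u n) :
    DifferentiableOn ℂ (fun x => ∑' n, f n x) U := by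
  intro x hx
  obtain ⟨ε, hε, hball⟩ := Metric.isOpen_iff.1 hU x hx
  have hsub : ∀ y ∈ Metric.ball x (ε / 2), Metric.ball y (ε / 2) ⊆ U := fun y hy =>
    (Metric.ball_subset_ball' (by have := Metric.mem_ball.1 hy; linarith)).trans hball
  have hmem : ∀ y ∈ Metric.ball x (ε / 2), y ∈ U := fun y hy =>
    hsub y hy (Metric.mem_ball_self (by positivity))
  have hx' : x ∈ Metric.ball x (ε / 2) := Metric.mem_ball_self (by positivity)
  have key := hasFDerivAt_tsum_of_isPreconnected (𝕜 := ℂ) (f := f) (f' := fun n => fderiv ℂ (f n))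
    (u := fun n => (2 * u n) / (ε / 2)) ((hu.mul_left 2).div_const _)
    (Metric.isOpen_ball (x := x) (ε := ε / 2))
    (convex_ball x (ε / 2)).isPreconnected
    (fun n y hy => ((hf n).differentiableAt (hU.mem_nhds (hmem y hy))).hasFDerivAt)
    (fun n y hy => ?_) hx' (Summable.of_norm_bounded hu fun n => hb n x hx) hx'
  · exact key.differentiableAt.differentiableWithinAt
  · refine Complex.norm_fderiv_le_div_of_mapsTo_ball ((hf n).mono (hsub y hy)) ?_ (by positivity)
    intro z hz
    rw [mem_closedBall_iff_norm]
    calc ‖f n z - f n y‖ ≤ ‖f n z‖ + ‖f n y‖ := norm_sub_le _ _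
      _ ≤ 2 * u n := by linarith [hb n z (hsub y hy hz), hb n y (hmem y hy)]

/-- The identity theorem on a convex open set, reduced to one variable by restricting to complex
lines. -/
theorem eqOn_of_convex_of_eventuallyEq {f g : E → ℂ} {U : Set E} (hU : IsOpen U)
    (hconv : Convex ℝ U) (hf : DifferentiableOn ℂ f U) (hg : DifferentiableOn ℂ g U)
    {a : E} (ha : a ∈ U) (hfg : f =ᶠ[𝓝 a] g) : Set.EqOn f g U := by
  intro x hx
  let ℓ : ℂ →ᵃ[ℂ] E := AffineMap.lineMap a x
  have hℓd : Differentiable ℂ (fun t : ℂ => ℓ t) := by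
    simp only [ℓ, AffineMap.lineMap_apply_module]; fun_prop
  have hℓ0 : ℓ 0 = a := by simp [ℓ]
  have hℓ1 : ℓ 1 = x := by simp [ℓ]
  set V : Set ℂ := (fun t => ℓ t) ⁻¹' U with hV
  have hVo : IsOpen V := hU.preimage hℓd.continuous
  have hVc : Convex ℝ V := by
    intro t ht u hu p q hp hq hpq
    have : ℓ (p • t + q • u) = p • ℓ t + q • ℓ u := by
      obtain rfl : q = 1 - p := by linarith
      simp only [ℓ, AffineMap.lineMap_apply_module, ← Complex.coe_smul]
      push_cast
      module
    simpa only [hV, Set.mem_preimage, this] using hconv ht hu hp hq hpq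
  have h1 : AnalyticOnNhd ℂ (fun t => f (ℓ t)) V :=
    (hf.comp hℓd.differentiableOn (fun t ht => ht)).analyticOnNhd hVo
  have h2 : AnalyticOnNhd ℂ (fun t => g (ℓ t)) V :=
    (hg.comp hℓd.differentiableOn (fun t ht => ht)).analyticOnNhd hVo
  have h0 : (0 : ℂ) ∈ V := by simpa [hV, hℓ0] using ha
  have hev : (fun t => f (ℓ t)) =ᶠ[𝓝 0] fun t => g (ℓ t) := by
    have hc : Tendsto (fun t => ℓ t) (𝓝 0) (𝓝 a) := by
      have := hℓd.continuous.tendsto 0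
      rwa [hℓ0] at this
    exact hc.eventually hfg
  have := h1.eqOn_of_preconnected_of_eventuallyEq h2 hVc.isPreconnected h0 hev
    (show (1 : ℂ) ∈ V by simpa [hV, hℓ1] using hx)
  simpa [hℓ1] using this

/-- A function on a nonempty open set `Ω` which extends holomorphically from `Ω` to every ball
around the origin extends to an entire function. -/
theorem exists_entire_of_forall_ball {Ω : Set E} (hΩ : IsOpen Ω) {a : E} (ha : a ∈ Ω) {T : E → ℂ}
    (h : ∀ R : ℝ, ‖a‖ < R → ∃ g, DifferentiableOn ℂ g (Metric.ball 0 R) ∧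
      ∀ x ∈ Metric.ball (0 : E) R, x ∈ Ω → g x = T x) :
    ∃ G : E → ℂ, Differentiable ℂ G ∧ (∀ x ∈ Ω, G x = T x) ∧
      ∀ R : ℝ, ‖a‖ < R → ∀ g, DifferentiableOn ℂ g (Metric.ball 0 R) →
        (∀ x ∈ Metric.ball (0 : E) R, x ∈ Ω → g x = T x) → ∀ x ∈ Metric.ball (0 : E) R, G x = g x := by
  choose! g hg using h
  have uniq : ∀ R : ℝ, ‖a‖ < R → ∀ g₁ g₂ : E → ℂ, DifferentiableOn ℂ g₁ (Metric.ball 0 R) →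
      DifferentiableOn ℂ g₂ (Metric.ball 0 R) →
      (∀ x ∈ Metric.ball (0 : E) R, x ∈ Ω → g₁ x = T x) →
      (∀ x ∈ Metric.ball (0 : E) R, x ∈ Ω → g₂ x = T x) →
      ∀ x ∈ Metric.ball (0 : E) R, g₁ x = g₂ x := by
    intro R hR g₁ g₂ h₁ h₂ e₁ e₂
    have haR : a ∈ Metric.ball (0 : E) R := by simpa using hR
    refine eqOn_of_convex_of_eventuallyEq Metric.isOpen_ball (convex_ball _ _) h₁ h₂ haR ?_
    filter_upwards [Metric.isOpen_ball.mem_nhds haR, hΩ.mem_nhds ha] with x hx hx'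
    rw [e₁ x hx hx', e₂ x hx hx']
  let ρ : E → ℝ := fun x => max ‖a‖ ‖x‖ + 1
  have hρa : ∀ x, ‖a‖ < ρ x := fun x => (le_max_left _ _).trans_lt (lt_add_one _)
  have hρx : ∀ x, x ∈ Metric.ball (0 : E) (ρ x) := fun x => by
    simpa using (le_max_right ‖a‖ ‖x‖).trans_lt (lt_add_one _)
  have hG : ∀ R : ℝ, ‖a‖ < R → ∀ x ∈ Metric.ball (0 : E) R, g (ρ x) x = g R x := by
    intro R hR x hx
    have hm : ‖a‖ < min R (ρ x) := lt_min hR (hρa x)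
    have s1 : Metric.ball (0 : E) (min R (ρ x)) ⊆ Metric.ball 0 R :=
      Metric.ball_subset_ball (min_le_left _ _)
    have s2 : Metric.ball (0 : E) (min R (ρ x)) ⊆ Metric.ball 0 (ρ x) :=
      Metric.ball_subset_ball (min_le_right _ _)
    refine uniq _ hm _ _ ((hg _ (hρa x)).1.mono s2) ((hg R hR).1.mono s1)
      (fun y hy => (hg _ (hρa x)).2 y (s2 hy)) (fun y hy => (hg R hR).2 y (s1 hy)) x ?_
    have h1 := hρx x
    simp only [Metric.mem_ball, dist_zero_right] at hx h1 ⊢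
    exact lt_min hx h1
  refine ⟨fun x => g (ρ x) x, fun x => ?_, fun x hx => (hg _ (hρa x)).2 x (hρx x) hx, ?_⟩
  · have hn : Metric.ball (0 : E) (ρ x) ∈ 𝓝 x := Metric.isOpen_ball.mem_nhds (hρx x)
    refine ((hg _ (hρa x)).1.differentiableAt hn).congr_of_eventuallyEq ?_
    filter_upwards [hn] with y hy using hG _ (hρa x) y hy
  · intro R hR g' hd he x hx
    refine (hG R hR x hx).trans ?_
    exact uniq R hR _ _ (hg R hR).1 hd (hg R hR).2 he x hx

theorem exists_norm_le_of_differentiable [ProperSpace E] {c : E → ℂ} (hc : Differentiable ℂ c)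
    (R : ℝ) : ∃ C : ℕ, ∀ s, ‖s‖ ≤ R → ‖c s‖ ≤ C := by
  obtain ⟨C, hC⟩ := (isCompact_closedBall (0 : E) R).exists_bound_of_continuousOn
    hc.continuous.continuousOn
  obtain ⟨N, hN⟩ := exists_nat_ge C
  exact ⟨N, fun s hs => (hC s (by simpa using hs)).trans hN⟩

theorem differentiable_finsetProd {ι : Type*} {f : ι → E → ℂ} (t : Finset ι)
    (hf : ∀ i ∈ t, Differentiable ℂ (f i)) : Differentiable ℂ fun s => ∏ i ∈ t, f i s := by
  classical
  induction t using Finset.induction_on with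
  | empty => simp
  | insert i t hi ih =>
    simp only [Finset.prod_insert hi]
    exact (hf i (Finset.mem_insert_self i t)).mul
      (ih fun j hj => hf j (Finset.mem_insert_of_mem hj))

end SeveralVariables

/-! ### The binomial expansion with remainder -/

/-- The coefficient of `x ^ l` in the binomial series of `(1 + x) ^ (-z)`. -/
noncomputable def binomCoeff (z : ℂ) (l : ℕ) : ℂ :=
  (∏ i ∈ Finset.range l, -(z + i)) / (l.factorial : ℂ)

@[simp] theorem binomCoeff_zero (z : ℂ) : binomCoeff z 0 = 1 := by simp [binomCoeff]

theorem differentiable_binomCoeff (l : ℕ) : Differentiable ℂ fun z => binomCoeff z l := by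
  unfold binomCoeff
  fun_prop

theorem succ_mul_binomCoeff_succ (z : ℂ) (l : ℕ) :
    (l + 1 : ℂ) * binomCoeff z (l + 1) = -z * binomCoeff (z + 1) l := by
  have hl : (l + 1 : ℂ) ≠ 0 := by exact_mod_cast l.succ_ne_zero
  have hf : (l.factorial : ℂ) ≠ 0 := by exact_mod_cast l.factorial_ne_zero
  have hp : ∏ i ∈ Finset.range l, -(z + ((i + 1 : ℕ) : ℂ)) =
      ∏ i ∈ Finset.range l, -(z + 1 + (i : ℂ)) :=
    Finset.prod_congr rfl fun i _ => by push_cast; ring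
  simp only [binomCoeff, Finset.prod_range_succ', Nat.factorial_succ, hp]
  push_cast
  field_simp
  simp [mul_comm]

/-- Taylor's formula for `(1 + x) ^ (-z)` on `[0, 1]`, uniformly for `z` in a disc. The remainder of
order `L + 1` vanishes at `0` and its derivative is `-z` times the remainder of order `L` for
`z + 1`. -/
theorem exists_norm_binomial_remainder_le (L : ℕ) : ∀ ρ : ℝ, 0 ≤ ρ → ∃ C : ℝ, ∀ z : ℂ, ‖z‖ ≤ ρ →
    ∀ x : ℝ, 0 ≤ x → x ≤ 1 →
      ‖(1 + (x : ℂ)) ^ (-z) - ∑ l ∈ Finset.range L, binomCoeff z l * (x : ℂ) ^ l‖ ≤ C * x ^ L := by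
  induction L with
  | zero =>
    intro ρ hρ
    refine ⟨2 ^ ρ, fun z hz x hx0 hx1 => ?_⟩
    have h1 : (1 + (x : ℂ)) = ((1 + x : ℝ) : ℂ) := by push_cast; ring
    simp only [Finset.range_zero, Finset.sum_empty, sub_zero, pow_zero, mul_one]
    rw [h1, Complex.norm_cpow_eq_rpow_re_of_pos (by linarith)]
    calc (1 + x) ^ (-z).re ≤ (1 + x) ^ ρ := by
          refine Real.rpow_le_rpow_of_exponent_le (by linarith) ?_
          have := (abs_le.1 (Complex.abs_re_le_norm z)).1
          rw [Complex.neg_re]; linarith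
      _ ≤ 2 ^ ρ := Real.rpow_le_rpow (by linarith) (by linarith) hρ
  | succ L ih =>
    intro ρ hρ
    obtain ⟨C, hC⟩ := ih (ρ + 1) (by linarith)
    refine ⟨ρ * C, fun z hz x hx0 hx1 => ?_⟩
    have hz1 : ‖z + 1‖ ≤ ρ + 1 := (norm_add_le _ _).trans (by simpa using hz)
    have hder : ∀ t ∈ Set.Icc (0 : ℝ) x, HasDerivWithinAt
        (fun t : ℝ => (1 + (t : ℂ)) ^ (-z) -
          ∑ l ∈ Finset.range (L + 1), binomCoeff z l * (t : ℂ) ^ l)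
        (-z * ((1 + (t : ℂ)) ^ (-(z + 1)) -
          ∑ l ∈ Finset.range L, binomCoeff (z + 1) l * (t : ℂ) ^ l)) (Set.Icc 0 x) t := by
      intro t ht
      have hs : (1 + (t : ℂ)) ∈ Complex.slitPlane := by
        refine Or.inl ?_
        simpa using (by linarith [ht.1] : (0 : ℝ) < 1 + t)
      have d1 : HasDerivAt (fun y : ℂ => (1 + y) ^ (-z)) (-z * (1 + (t : ℂ)) ^ (-z - 1) * 1) t :=
        ((hasDerivAt_id (t : ℂ)).const_add 1).cpow_const hs
      have d2 : HasDerivAt (fun y : ℂ => ∑ l ∈ Finset.range (L + 1), binomCoeff z l * y ^ l)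
          (∑ l ∈ Finset.range (L + 1), binomCoeff z l * (l * (t : ℂ) ^ (l - 1))) t :=
        HasDerivAt.fun_sum fun l _ => (hasDerivAt_pow l (t : ℂ)).const_mul _
      have d3 := (d1.sub d2).comp_ofReal
      refine HasDerivAt.hasDerivWithinAt ?_
      refine d3.congr_deriv ?_
      rw [Finset.sum_range_succ', mul_sub, Finset.mul_sum]
      have : ∀ l : ℕ, binomCoeff z (l + 1) * (((l + 1 : ℕ) : ℂ) * (t : ℂ) ^ (l + 1 - 1)) =
          -z * (binomCoeff (z + 1) l * (t : ℂ) ^ l) := fun l => by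
        rw [← mul_assoc (-z), ← succ_mul_binomCoeff_succ]; push_cast; ring
      simp only [this]
      simp [sub_eq_add_neg, add_comm]
    have hC0 : 0 ≤ C := by
      have := (norm_nonneg _).trans (hC (z + 1) hz1 1 zero_le_one le_rfl)
      simpa using this
    have := norm_image_sub_le_of_norm_deriv_le_segment' hder (C := ρ * (C * x ^ L)) ?_ x ⟨hx0, le_rfl⟩
    · have e0 : (1 + ((0 : ℝ) : ℂ)) ^ (-z) -
          ∑ l ∈ Finset.range (L + 1), binomCoeff z l * ((0 : ℝ) : ℂ) ^ l = 0 := by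
        simp [Finset.sum_range_succ']
      rw [e0, sub_zero, sub_zero] at this
      refine this.trans (le_of_eq ?_)
      ring
    · intro t ht
      rw [norm_mul, norm_neg]
      refine mul_le_mul hz ((hC _ hz1 t ht.1 (ht.2.le.trans hx1)).trans ?_) (norm_nonneg _) hρ
      gcongr
      · exact ht.1
      · exact ht.2.le

/-! ### Symbols: sequences with asymptotic expansions in inverse powers -/

section Symbols

set_option linter.unusedSectionVars false

variable {E : Type*} [NormedAddCommGroup E] [NormedSpace ℂ E]

/-- The polynomials in `1 / n` whose coefficients are entire functions of `s`, as functions of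
`n` and `s`. -/
def invPoly (E : Type*) [NormedAddCommGroup E] [NormedSpace ℂ E] : AddSubmonoid (ℕ → E → ℂ) :=
  AddSubmonoid.closure {f | ∃ (c : E → ℂ) (k : ℕ), Differentiable ℂ c ∧
    f = fun (n : ℕ) s => c s * ((n : ℂ)⁻¹) ^ k}

/-- `f n s = O(n ^ (-K))` for `n ≥ 1`, uniformly for `s` in the closed ball of radius `R`. -/
def IsBigOOnBall (R : ℝ) (K : ℕ) (f : ℕ → E → ℂ) : Prop :=
  ∃ C : ℝ, ∀ n : ℕ, 1 ≤ n → ∀ s : E, ‖s‖ ≤ R → ‖f n s‖ ≤ C * ((n : ℝ)⁻¹) ^ K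

/-- A symbol: a sequence (`n ≥ 1`) of entire functions of `s` which on every ball and to every order
has an asymptotic expansion in powers of `1 / n` with entire coefficients. Expansions for
different balls and orders need not be compatible. -/
structure IsSymbol (f : ℕ → E → ℂ) : Prop where
  differentiable : ∀ n, 1 ≤ n → Differentiable ℂ (f n)
  exists_approx : ∀ (R : ℝ) (K : ℕ), ∃ p ∈ invPoly E, IsBigOOnBall R K (f - p)

theorem IsBigOOnBall.nonneg {R : ℝ} {K : ℕ} {f : ℕ → E → ℂ} (hf : IsBigOOnBall R K f) :
    ∃ C : ℝ, 0 ≤ C ∧ ∀ n : ℕ, 1 ≤ n → ∀ s : E, ‖s‖ ≤ R → ‖f n s‖ ≤ C * ((n : ℝ)⁻¹) ^ K := by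
  obtain ⟨C, hC⟩ := hf
  refine ⟨max C 0, le_max_right _ _, fun n hn s hs => (hC n hn s hs).trans ?_⟩
  gcongr
  exact le_max_left _ _

theorem IsBigOOnBall.congr {R : ℝ} {K : ℕ} {f g : ℕ → E → ℂ} (hf : IsBigOOnBall R K f)
    (h : ∀ n : ℕ, 1 ≤ n → ∀ s : E, ‖s‖ ≤ R → f n s = g n s) : IsBigOOnBall R K g := by
  obtain ⟨C, hC⟩ := hf
  exact ⟨C, fun n hn s hs => h n hn s hs ▸ hC n hn s hs⟩

theorem IsBigOOnBall.mono {R : ℝ} {K K' : ℕ} {f : ℕ → E → ℂ} (hf : IsBigOOnBall R K f)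
    (h : K' ≤ K) : IsBigOOnBall R K' f := by
  obtain ⟨C, hC0, hC⟩ := hf.nonneg
  refine ⟨C, fun n hn s hs => (hC n hn s hs).trans ?_⟩
  have : ((n : ℝ)⁻¹) ≤ 1 := inv_le_one_of_one_le₀ (by exact_mod_cast hn)
  exact mul_le_mul_of_nonneg_left (pow_le_pow_of_le_one (by positivity) this h) hC0

theorem IsBigOOnBall.mono_ball {R R' : ℝ} {K : ℕ} {f : ℕ → E → ℂ} (hf : IsBigOOnBall R K f)
    (h : R' ≤ R) : IsBigOOnBall R' K f := by
  obtain ⟨C, hC⟩ := hf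
  exact ⟨C, fun n hn s hs => hC n hn s (hs.trans h)⟩

theorem isBigOOnBall_zero (R : ℝ) (K : ℕ) : IsBigOOnBall R K (0 : ℕ → E → ℂ) :=
  ⟨0, fun n _ s _ => by simp⟩

theorem IsBigOOnBall.add {R : ℝ} {K : ℕ} {f g : ℕ → E → ℂ} (hf : IsBigOOnBall R K f)
    (hg : IsBigOOnBall R K g) : IsBigOOnBall R K (f + g) := by
  obtain ⟨C, hC⟩ := hf
  obtain ⟨D, hD⟩ := hg
  refine ⟨C + D, fun n hn s hs => (norm_add_le _ _).trans ?_⟩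
  linarith [hC n hn s hs, hD n hn s hs]

theorem IsBigOOnBall.mul {R : ℝ} {K L : ℕ} {f g : ℕ → E → ℂ} (hf : IsBigOOnBall R K f)
    (hg : IsBigOOnBall R L g) : IsBigOOnBall R (K + L) (f * g) := by
  obtain ⟨C, hC0, hC⟩ := hf.nonneg
  obtain ⟨D, hD⟩ := hg
  refine ⟨C * D, fun n hn s hs => (norm_mul_le _ _).trans ?_⟩
  refine (mul_le_mul (hC n hn s hs) (hD n hn s hs) (norm_nonneg _) (by positivity)).trans ?_
  exact le_of_eq (by ring)

theorem IsBigOOnBall.sum {ι : Type*} {R : ℝ} {K : ℕ} {f : ι → ℕ → E → ℂ} (t : Finset ι)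
    (hf : ∀ i ∈ t, IsBigOOnBall R K (f i)) : IsBigOOnBall R K (∑ i ∈ t, f i) :=
  Finset.sum_induction f (IsBigOOnBall R K) (fun _ _ => IsBigOOnBall.add) (isBigOOnBall_zero R K) hf

theorem monomial_mem_invPoly {c : E → ℂ} (hc : Differentiable ℂ c) (k : ℕ) :
    (fun (n : ℕ) s => c s * ((n : ℂ)⁻¹) ^ k) ∈ invPoly E :=
  AddSubmonoid.subset_closure ⟨c, k, hc, rfl⟩

theorem mul_mem_invPoly {p q : ℕ → E → ℂ} (hp : p ∈ invPoly E) (hq : q ∈ invPoly E) :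
    p * q ∈ invPoly E := by
  induction hp, hq using AddSubmonoid.closure_induction₂ with
  | mem x y hx hy =>
    obtain ⟨c, k, hc, rfl⟩ := hx
    obtain ⟨d, l, hd, rfl⟩ := hy
    convert monomial_mem_invPoly (hc.mul hd) (k + l) using 1
    ext n s
    simp only [Pi.mul_apply]
    ring
  | zero_left => simp
  | zero_right => simp
  | add_left x y z _ _ _ h1 h2 => rw [add_mul]; exact add_mem h1 h2
  | add_right x y z _ _ _ h1 h2 => rw [mul_add]; exact add_mem h1 h2

theorem differentiable_of_mem_invPoly {p : ℕ → E → ℂ} (hp : p ∈ invPoly E) (n : ℕ) :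
    Differentiable ℂ (p n) := by
  induction hp using AddSubmonoid.closure_induction with
  | mem x hx =>
    obtain ⟨c, k, hc, rfl⟩ := hx
    exact hc.mul_const _
  | zero => exact differentiable_const 0
  | add x y _ _ h1 h2 => exact h1.add h2

theorem isBigOOnBall_of_entire [ProperSpace E] {c : E → ℂ} (hc : Differentiable ℂ c) (R : ℝ) :
    IsBigOOnBall R 0 (fun _ => c) := by
  obtain ⟨C, hC⟩ := exists_norm_le_of_differentiable hc R
  exact ⟨C, fun n _ s hs => by simpa using hC s hs⟩

theorem isBigOOnBall_inv_pow (R : ℝ) (k : ℕ) :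
    IsBigOOnBall R k (fun (n : ℕ) (_ : E) => ((n : ℂ)⁻¹) ^ k) :=
  ⟨1, fun n _ s _ => by simp⟩

theorem isBigOOnBall_of_mem_invPoly [ProperSpace E] {p : ℕ → E → ℂ} (hp : p ∈ invPoly E) (R : ℝ) :
    IsBigOOnBall R 0 p := by
  induction hp using AddSubmonoid.closure_induction with
  | mem x hx =>
    obtain ⟨c, k, hc, rfl⟩ := hx
    exact ((isBigOOnBall_of_entire hc R).mul (isBigOOnBall_inv_pow R k)).mono (Nat.zero_le _)
  | zero => exact isBigOOnBall_zero R 0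
  | add x y _ _ h1 h2 => exact h1.add h2

theorem isSymbol_of_mem_invPoly {p : ℕ → E → ℂ} (hp : p ∈ invPoly E) : IsSymbol p :=
  ⟨fun n _ => differentiable_of_mem_invPoly hp n,
    fun R K => ⟨p, hp, by simpa using isBigOOnBall_zero R K⟩⟩

theorem isSymbol_of_entire {c : E → ℂ} (hc : Differentiable ℂ c) : IsSymbol (fun _ : ℕ => c) := by
  have := isSymbol_of_mem_invPoly (monomial_mem_invPoly hc 0)
  simpa using this

theorem isSymbol_inv_pow (k : ℕ) : IsSymbol (fun (n : ℕ) (_ : E) => ((n : ℂ)⁻¹) ^ k) := by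
  have := isSymbol_of_mem_invPoly (monomial_mem_invPoly (E := E) (differentiable_const 1) k)
  simpa using this

theorem IsSymbol.isBigOOnBall [ProperSpace E] {f : ℕ → E → ℂ} (hf : IsSymbol f) (R : ℝ) :
    IsBigOOnBall R 0 f := by
  obtain ⟨p, hp, h⟩ := hf.exists_approx R 0
  simpa using h.add (isBigOOnBall_of_mem_invPoly hp R)

theorem IsSymbol.congr {f g : ℕ → E → ℂ} (hf : IsSymbol f)
    (h : ∀ n : ℕ, 1 ≤ n → ∀ s : E, f n s = g n s) : IsSymbol g := by
  refine ⟨fun n hn => ?_, fun R K => ?_⟩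
  · rw [← show f n = g n from funext (h n hn)]
    exact hf.differentiable n hn
  · obtain ⟨p, hp, hb⟩ := hf.exists_approx R K
    exact ⟨p, hp, hb.congr fun n hn s _ => by simp [h n hn s]⟩

theorem IsSymbol.add {f g : ℕ → E → ℂ} (hf : IsSymbol f) (hg : IsSymbol g) :
    IsSymbol (f + g) := by
  refine ⟨fun n hn => (hf.differentiable n hn).add (hg.differentiable n hn), fun R K => ?_⟩
  obtain ⟨p, hp, hb⟩ := hf.exists_approx R K
  obtain ⟨q, hq, hb'⟩ := hg.exists_approx R K
  exact ⟨p + q, add_mem hp hq, by rw [add_sub_add_comm]; exact hb.add hb'⟩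

theorem IsSymbol.mul [ProperSpace E] {f g : ℕ → E → ℂ} (hf : IsSymbol f) (hg : IsSymbol g) :
    IsSymbol (f * g) := by
  refine ⟨fun n hn => (hf.differentiable n hn).mul (hg.differentiable n hn), fun R K => ?_⟩
  obtain ⟨p, hp, hb⟩ := hf.exists_approx R K
  obtain ⟨q, hq, hb'⟩ := hg.exists_approx R K
  refine ⟨p * q, mul_mem_invPoly hp hq, ?_⟩
  have h1 := hb.mul (hg.isBigOOnBall R)
  have h2 := (isBigOOnBall_of_mem_invPoly hp R).mul hb'
  rw [Nat.zero_add] at h2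
  rw [show f * g - p * q = (f - p) * g + p * (g - q) by ring]
  exact h1.add h2

theorem IsSymbol.sub [ProperSpace E] {f g : ℕ → E → ℂ} (hf : IsSymbol f) (hg : IsSymbol g) :
    IsSymbol (f - g) := by
  refine (hf.add ((isSymbol_of_entire (differentiable_const (-1))).mul hg)).congr fun n _ s => ?_
  simp [sub_eq_add_neg]

/-- `(1 + α / n) ^ (-w(s))` is a symbol, by the binomial expansion. -/
theorem isSymbol_one_add_cpow [ProperSpace E] {w : E → ℂ} (hw : Differentiable ℂ w) {α : ℝ}
    (h0 : 0 ≤ α) (h1 : α ≤ 1) : IsSymbol (fun (n : ℕ) s => (1 + (α : ℂ) * (n : ℂ)⁻¹) ^ (-w s)) := by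
  have hx : ∀ n : ℕ, 1 ≤ n → 0 ≤ α * (n : ℝ)⁻¹ ∧ α * (n : ℝ)⁻¹ ≤ 1 := fun n hn => by
    have hn' : ((n : ℝ)⁻¹) ≤ 1 := inv_le_one_of_one_le₀ (by exact_mod_cast hn)
    exact ⟨by positivity, mul_le_one₀ h1 (by positivity) hn'⟩
  refine ⟨fun n hn => ?_, fun R K => ?_⟩
  · refine (hw.neg).const_cpow (Or.inl ?_)
    have := (hx n hn).1
    have h2 : ((1 + α * (n : ℝ)⁻¹ : ℝ) : ℂ) ≠ 0 := Complex.ofReal_ne_zero.2 (by positivity)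
    simpa using h2
  · obtain ⟨ρ, hρ⟩ := exists_norm_le_of_differentiable hw R
    obtain ⟨C, hC⟩ := exists_norm_binomial_remainder_le K ρ (Nat.cast_nonneg ρ)
    refine ⟨∑ l ∈ Finset.range K, fun (n : ℕ) s => (binomCoeff (w s) l * (α : ℂ) ^ l) * ((n : ℂ)⁻¹) ^ l,
      sum_mem fun l _ => monomial_mem_invPoly
        (((differentiable_binomCoeff l).comp hw).mul_const _) l, ⟨C * α ^ K, fun n hn s hs => ?_⟩⟩
    have := hC (w s) (hρ s hs) (α * (n : ℝ)⁻¹) (hx n hn).1 (hx n hn).2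
    rw [mul_pow, ← mul_assoc] at this
    simpa [Finset.sum_apply, mul_pow, mul_assoc] using this

end Symbols

/-! ### The difference equation -/

section DifferenceEquation

set_option linter.unusedSectionVars false

variable {E : Type*} [NormedAddCommGroup E] [NormedSpace ℂ E]

/-- With `v(n) = ζ ^ n * n ^ (δ - W) * q(n)`, the function `stepOp W δ ζ q n` is the difference
`v(n) - v(n + 1)` divided by `ζ ^ n * n ^ (-W)`. -/
noncomputable def stepOp (W : E → ℂ) (δ : ℕ) (ζ : ℂ) (q : ℕ → E → ℂ) (n : ℕ) (s : E) : ℂ :=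
  (n : ℂ) ^ W s * ((n : ℂ) ^ (δ - W s) * q n s -
    ζ * ((n + 1 : ℕ) : ℂ) ^ (δ - W s) * q (n + 1) s)

/-- The difference equation `stepOp W δ ζ q = h` has a symbol `q` as a solution up to an error
`O(n ^ (-K))` on the ball of radius `R`. -/
def IsSolvable (W : E → ℂ) (δ : ℕ) (ζ : ℂ) (R : ℝ) (K : ℕ) (h : ℕ → E → ℂ) : Prop :=
  ∃ q, IsSymbol q ∧ IsBigOOnBall R K (h - stepOp W δ ζ q)

variable {W : E → ℂ} {δ : ℕ} {ζ : ℂ} {R : ℝ} {K : ℕ} {h h' : ℕ → E → ℂ}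

theorem IsBigOOnBall.isSolvable (hh : IsBigOOnBall R K h) : IsSolvable W δ ζ R K h := by
  refine ⟨0, isSymbol_of_mem_invPoly (zero_mem _), hh.congr fun n _ s _ => ?_⟩
  simp [stepOp]

theorem IsSolvable.congr (hh : IsSolvable W δ ζ R K h)
    (e : ∀ n : ℕ, 1 ≤ n → ∀ s : E, h n s = h' n s) : IsSolvable W δ ζ R K h' := by
  obtain ⟨q, hq, hb⟩ := hh
  exact ⟨q, hq, hb.congr fun n hn s _ => by simp [e n hn s]⟩

theorem IsSolvable.add (hh : IsSolvable W δ ζ R K h) (hh' : IsSolvable W δ ζ R K h') :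
    IsSolvable W δ ζ R K (h + h') := by
  obtain ⟨q, hq, hb⟩ := hh
  obtain ⟨q', hq', hb'⟩ := hh'
  refine ⟨q + q', hq.add hq', (hb.add hb').congr fun n _ s _ => ?_⟩
  simp only [stepOp, Pi.add_apply, Pi.sub_apply]
  ring

theorem IsSolvable.sum {ι : Type*} {f : ι → ℕ → E → ℂ} (t : Finset ι)
    (hf : ∀ i ∈ t, IsSolvable W δ ζ R K (f i)) : IsSolvable W δ ζ R K (∑ i ∈ t, f i) :=
  Finset.sum_induction f (IsSolvable W δ ζ R K) (fun _ _ => IsSolvable.add)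
    (isBigOOnBall_zero R K).isSolvable hf

theorem IsSolvable.entire_mul [ProperSpace E] {c : E → ℂ} (hc : Differentiable ℂ c)
    (hh : IsSolvable W δ ζ R K h) : IsSolvable W δ ζ R K ((fun _ => c) * h) := by
  obtain ⟨q, hq, hb⟩ := hh
  refine ⟨(fun _ => c) * q, (isSymbol_of_entire hc).mul hq, ?_⟩
  have := (isBigOOnBall_of_entire hc R).mul hb
  rw [Nat.zero_add] at this
  refine this.congr fun n _ s _ => ?_
  simp only [stepOp, Pi.mul_apply, Pi.sub_apply]
  ring

theorem isSolvable_stepOp {q : ℕ → E → ℂ} (hq : IsSymbol q) :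
    IsSolvable W δ ζ R K (stepOp W δ ζ q) :=
  ⟨q, hq, by simpa using isBigOOnBall_zero R K⟩

/-- The function `n ^ W(s) * (n + α) ^ (-(W(s) + z))`. -/
noncomputable def shiftedPow (W : E → ℂ) (α : ℝ) (z : ℂ) (n : ℕ) (s : E) : ℂ :=
  (n : ℂ) ^ W s * ((n : ℂ) + α) ^ (-(W s + z))

theorem natCast_add_cpow {n : ℕ} (hn : 1 ≤ n) {α : ℝ} (hα : 0 ≤ α) (z : ℂ) :
    ((n : ℂ) + α) ^ z = (n : ℂ) ^ z * (1 + (α : ℂ) * (n : ℂ)⁻¹) ^ z := by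
  have hn0 : (n : ℂ) ≠ 0 := by exact_mod_cast (by lia : n ≠ 0)
  have h1 := Complex.mul_cpow_ofReal_nonneg (a := (n : ℝ)) (b := 1 + α * (n : ℝ)⁻¹)
    (by positivity) (by positivity) z
  push_cast at h1
  rw [← h1, mul_add, mul_one, mul_comm (α : ℂ), mul_inv_cancel_left₀ hn0]

theorem shiftedPow_natCast {n : ℕ} (hn : 1 ≤ n) {α : ℝ} (h0 : 0 ≤ α) (j : ℕ) (s : E) :
    shiftedPow W α j n s =
      (1 + (α : ℂ) * (n : ℂ)⁻¹) ^ (-(W s + j)) * ((n : ℂ)⁻¹) ^ j := by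
  have hn0 : (n : ℂ) ≠ 0 := by exact_mod_cast (by lia : n ≠ 0)
  rw [shiftedPow, natCast_add_cpow hn h0, ← mul_assoc, ← Complex.cpow_add _ _ hn0,
    show W s + -(W s + j) = -((j : ℕ) : ℂ) by ring, Complex.cpow_neg, Complex.cpow_natCast,
    inv_pow, mul_comm]

theorem shiftedPow_zero {n : ℕ} (hn : 1 ≤ n) (j : ℕ) (s : E) :
    shiftedPow W 0 (j : ℂ) n s = ((n : ℂ)⁻¹) ^ j := by
  simp [shiftedPow_natCast hn le_rfl]

theorem isSymbol_shiftedPow [ProperSpace E] (hW : Differentiable ℂ W) {α : ℝ} (h0 : 0 ≤ α)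
    (h1 : α ≤ 1) (j : ℕ) : IsSymbol (shiftedPow W α j) := by
  exact ((isSymbol_one_add_cpow (hW.add_const (j : ℂ)) h0 h1).mul
    (isSymbol_inv_pow j)).congr fun n hn s => (shiftedPow_natCast hn h0 j s).symm

theorem isBigOOnBall_shiftedPow [ProperSpace E] (hW : Differentiable ℂ W) {α : ℝ} (h0 : 0 ≤ α)
    (h1 : α ≤ 1) (R : ℝ) (j : ℕ) : IsBigOOnBall R j (shiftedPow W α j) := by
  have hs := ((isSymbol_one_add_cpow (hW.add_const (j : ℂ)) h0 h1).isBigOOnBall R).mul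
    (isBigOOnBall_inv_pow R j)
  rw [Nat.zero_add] at hs
  exact hs.congr fun n hn s _ => (shiftedPow_natCast hn h0 j s).symm

/-- The expansion of `stepOp` on a single power of `n + α`, normalised so that
`n ^ (δ - W) * q(n) = (n + α) ^ (δ - W - j)`. -/
theorem exists_stepOp_expansion [ProperSpace E] (hW : Differentiable ℂ W) {α : ℝ} (h0 : 0 ≤ α)
    (h1 : α ≤ 1) (hδ : δ ≤ 1) (ζ : ℂ) (j : ℕ) (R : ℝ) (K : ℕ) :
    ∃ q, IsSymbol q ∧ IsBigOOnBall R K (fun n s => stepOp W δ ζ q n s -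
      ((1 - ζ) * shiftedPow W α ((j : ℂ) - δ) n s - ζ * ∑ l ∈ Finset.range K,
        binomCoeff (W s + j - δ) (l + 1) * shiftedPow W α ((j : ℂ) - δ + l + 1) n s)) := by
  have hWδ : Differentiable ℂ fun s => W s - δ := hW.sub_const _
  refine ⟨shiftedPow (fun s => W s - δ) α j, isSymbol_shiftedPow hWδ h0 h1 j, ?_⟩
  obtain ⟨ρ, hρ⟩ := exists_norm_le_of_differentiable (hW.add_const ((j : ℂ) - δ)) R
  obtain ⟨C, hC⟩ := exists_norm_binomial_remainder_le (K + 1) ρ (Nat.cast_nonneg ρ)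
  obtain ⟨D, hD0, hD⟩ := ((isSymbol_shiftedPow hW h0 h1 0).isBigOOnBall R).nonneg
  have hC0 : ∀ s : E, ‖s‖ ≤ R → 0 ≤ C := fun s hs => by
    simpa using (norm_nonneg _).trans (hC _ (hρ s hs) 1 zero_le_one le_rfl)
  refine ⟨‖ζ‖ * (D * C), fun n hn s hs => ?_⟩
  have hnr : (1 : ℝ) ≤ n := by exact_mod_cast hn
  have hn0 : (n : ℂ) ≠ 0 := by exact_mod_cast (by lia : n ≠ 0)
  have hn1 : ((n + 1 : ℕ) : ℂ) ≠ 0 := by exact_mod_cast n.succ_ne_zero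
  set N : ℝ := n + α with hN
  have hN1 : 1 ≤ N := by linarith
  have hNpos : 0 < N := by linarith
  have hNc : (n : ℂ) + α = (N : ℂ) := by rw [hN]; push_cast; rfl
  have hN0 : (N : ℂ) ≠ 0 := by exact_mod_cast hNpos.ne'
  set z : ℂ := W s + j - δ with hz
  have hx1 : N⁻¹ ≤ 1 := inv_le_one_of_one_le₀ hN1
  have hrem := hC z (by simpa [hz, add_sub_assoc] using hρ s hs) N⁻¹ (by positivity) hx1
  set r : ℂ := (1 + ((N⁻¹ : ℝ) : ℂ)) ^ (-z) -
    ∑ l ∈ Finset.range (K + 1), binomCoeff z l * ((N⁻¹ : ℝ) : ℂ) ^ l with hr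
  -- the shifted power at `n + 1`, factored at `N = n + α`
  have hsucc : (((n + 1 : ℕ) : ℂ) + α) ^ (-z) = (N : ℂ) ^ (-z) * (1 + ((N⁻¹ : ℝ) : ℂ)) ^ (-z) := by
    have := Complex.mul_cpow_ofReal_nonneg (a := N) (b := 1 + N⁻¹) hNpos.le (by positivity) (-z)
    push_cast at this ⊢
    rw [← this, mul_add, mul_inv_cancel₀ hN0, ← hNc]
    ring_nf
  have hpow : ∀ l : ℕ, (n : ℂ) ^ W s * (N : ℂ) ^ (-z) * ((N⁻¹ : ℝ) : ℂ) ^ (l + 1) =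
      shiftedPow W α ((j : ℂ) - δ + l + 1) n s := fun l => by
    rw [shiftedPow, hNc, mul_assoc, Complex.ofReal_inv, inv_pow, ← Complex.cpow_natCast,
      ← Complex.cpow_neg, ← Complex.cpow_add _ _ hN0]
    congr 2
    push_cast [hz]
    ring
  have hpow0 : (n : ℂ) ^ W s * (N : ℂ) ^ (-z) = shiftedPow W α ((j : ℂ) - δ) n s := by
    rw [shiftedPow, hNc, hz, add_sub_assoc]
  have hq : stepOp W δ ζ (shiftedPow (fun s => W s - δ) α j) n s =
      (n : ℂ) ^ W s * ((N : ℂ) ^ (-z) - ζ * (((n + 1 : ℕ) : ℂ) + α) ^ (-z)) := by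
    have e1 : -(W s - δ + j) = -z := by rw [hz]; ring
    have e2 : ∀ x : ℂ, x ≠ 0 → x ^ (δ - W s) * x ^ (W s - δ) = 1 := fun x hx => by
      rw [← Complex.cpow_add _ _ hx]; simp
    rw [stepOp, shiftedPow, shiftedPow, e1, hNc, ← mul_assoc, e2 _ hn0, mul_assoc ζ, ← mul_assoc
      (((n + 1 : ℕ) : ℂ) ^ (δ - W s)), e2 _ hn1, one_mul, one_mul]
  have hmain : stepOp W δ ζ (shiftedPow (fun s => W s - δ) α j) n s -
      ((1 - ζ) * shiftedPow W α ((j : ℂ) - δ) n s - ζ * ∑ l ∈ Finset.range K,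
        binomCoeff z (l + 1) * shiftedPow W α ((j : ℂ) - δ + l + 1) n s) =
      -ζ * ((n : ℂ) ^ W s * (N : ℂ) ^ (-z) * r) := by
    rw [hq, hsucc, hr, Finset.sum_range_succ']
    simp only [← hpow, ← hpow0, binomCoeff_zero, pow_zero, mul_one]
    have : ∀ l, binomCoeff z (l + 1) * ((n : ℂ) ^ W s * (N : ℂ) ^ (-z) * ((N⁻¹ : ℝ) : ℂ) ^ (l + 1)) =
      (n : ℂ) ^ W s * (N : ℂ) ^ (-z) * (binomCoeff z (l + 1) * ((N⁻¹ : ℝ) : ℂ) ^ (l + 1)) :=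
      fun l => by ring
    simp only [this, ← Finset.mul_sum]
    ring
  have hbase : ‖(n : ℂ) ^ W s * (N : ℂ) ^ (-z)‖ ≤ D * N := by
    have e : (n : ℂ) ^ W s * (N : ℂ) ^ (-z) =
        shiftedPow W α (0 : ℕ) n s * (N : ℂ) ^ (((δ : ℝ) - j : ℝ) : ℂ) := by
      rw [shiftedPow, hNc, mul_assoc, ← Complex.cpow_add _ _ hN0]
      congr 2
      push_cast [hz]
      ring
    rw [e, norm_mul]
    refine mul_le_mul (by simpa using hD n hn s hs) ?_ (norm_nonneg _) hD0
    rw [Complex.norm_cpow_eq_rpow_re_of_pos hNpos, Complex.ofReal_re]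
    calc N ^ ((δ : ℝ) - j) ≤ N ^ (1 : ℝ) := by
          refine Real.rpow_le_rpow_of_exponent_le hN1 ?_
          have : (δ : ℝ) ≤ 1 := by exact_mod_cast hδ
          linarith [(Nat.cast_nonneg j : (0 : ℝ) ≤ j)]
      _ = N := Real.rpow_one N
  refine (congrArg norm hmain).trans_le ?_
  rw [norm_mul, norm_neg, norm_mul, mul_assoc ‖ζ‖]
  refine mul_le_mul_of_nonneg_left ?_ (norm_nonneg _)
  calc ‖(n : ℂ) ^ W s * (N : ℂ) ^ (-z)‖ * ‖r‖ ≤ (D * N) * (C * N⁻¹ ^ (K + 1)) :=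
        mul_le_mul hbase hrem (norm_nonneg _) (by positivity)
    _ = D * C * N⁻¹ ^ K := by rw [pow_succ]; field_simp
    _ ≤ D * C * (n : ℝ)⁻¹ ^ K := by
        have := hC0 s hs
        gcongr
        linarith

/-- If `ζ ≠ 1`, the leading coefficient `1 - ζ` of `stepOp` is invertible and the difference
equation is solved for inverse powers successively, in order of decreasing size. -/
theorem isSolvable_inv_pow [ProperSpace E] (hW : Differentiable ℂ W) (hζ : ζ ≠ 1) (R : ℝ) (K : ℕ)
    (d : ℕ) : ∀ j, K ≤ j + d →
      IsSolvable W 0 ζ R K (fun (n : ℕ) (_ : E) => ((n : ℂ)⁻¹) ^ j) := by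
  induction d with
  | zero => exact fun j hj => ((isBigOOnBall_inv_pow R j).mono hj).isSolvable
  | succ d ih =>
    intro j hj
    obtain ⟨q, hq, hb⟩ := exists_stepOp_expansion hW (le_refl 0) zero_le_one (Nat.zero_le 1)
      ζ j R K
    have hζ' : 1 - ζ ≠ 0 := sub_ne_zero.2 hζ.symm
    have h3 := IsSolvable.sum (W := W) (δ := 0) (ζ := ζ) (R := R) (K := K) (Finset.range K)
      (f := fun l => (fun _ s => ζ * binomCoeff (W s + j) (l + 1)) *
        (fun (n : ℕ) (_ : E) => ((n : ℂ)⁻¹) ^ (j + l + 1)))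
      fun l _ => (ih (j + l + 1) (by lia)).entire_mul
        (((differentiable_binomCoeff (l + 1)).comp (hW.add_const _)).const_mul _)
    have h4 : IsSolvable W 0 ζ R K ((fun _ _ => -1) * (fun n s => stepOp W 0 ζ q n s -
      ((1 - ζ) * shiftedPow W 0 ((j : ℂ) - (0 : ℕ)) n s - ζ * ∑ l ∈ Finset.range K,
        binomCoeff (W s + j - (0 : ℕ)) (l + 1) *
          shiftedPow W 0 ((j : ℂ) - (0 : ℕ) + l + 1) n s))) :=
      hb.isSolvable.entire_mul (differentiable_const _)
    refine (IsSolvable.entire_mul (differentiable_const (1 - ζ)⁻¹)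
      (((isSolvable_stepOp hq).add h3).add h4)).congr fun n hn s => ?_
    have e1 : ∀ l : ℕ, shiftedPow W 0 ((j : ℂ) - (0 : ℕ) + l + 1) n s = ((n : ℂ)⁻¹) ^ (j + l + 1) :=
      fun l => by
        rw [← shiftedPow_zero (W := W) hn (j + l + 1) s]; push_cast; rw [sub_zero, add_assoc]
    have e2 : shiftedPow W 0 ((j : ℂ) - (0 : ℕ)) n s = ((n : ℂ)⁻¹) ^ j := by
      rw [← shiftedPow_zero (W := W) hn j s]; simp
    simp only [Pi.mul_apply, Pi.add_apply, Finset.sum_apply, e1, e2]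
    simp only [Nat.cast_zero, sub_zero, mul_assoc, ← Finset.mul_sum]
    field_simp
    ring

theorem IsSymbol.isSolvable [ProperSpace E] (hW : Differentiable ℂ W) (hζ : ζ ≠ 1)
    (hh : IsSymbol h) (R : ℝ) (K : ℕ) : IsSolvable W 0 ζ R K h := by
  obtain ⟨p, hp, hb⟩ := hh.exists_approx R K
  have hps : IsSolvable W 0 ζ R K p := by
    clear hb
    induction hp using AddSubmonoid.closure_induction with
    | mem x hx =>
      obtain ⟨c, k, hc, rfl⟩ := hx
      exact (isSolvable_inv_pow hW hζ R K K k (by lia)).entire_mul hc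
    | zero => exact (isBigOOnBall_zero R K).isSolvable
    | add x y _ _ h1 h2 => exact h1.add h2
  simpa using hb.isSolvable.add hps

/-- If `ζ = 1`, the leading coefficient of `stepOp` vanishes and the equation for `shiftedPow W α j`
requires a division by `W + j - 1`. The multipliers `(W - 1) W (W + 1) ⋯ (W + j - 1)` compensate for
this and reproduce themselves, since the coefficients of the binomial series are
products of the same factors. -/
theorem isSolvable_shiftedPow [ProperSpace E] (hW : Differentiable ℂ W) {α : ℝ} (h0 : 0 ≤ α)
    (h1 : α ≤ 1) (R : ℝ) (K : ℕ) (d : ℕ) : ∀ j : ℕ, K ≤ j + d →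
      IsSolvable W 1 1 R K (fun n s =>
        (∏ i ∈ Finset.range (j + 1), (W s - 1 + i)) * shiftedPow W α j n s) := by
  have hprod : ∀ j : ℕ, Differentiable ℂ fun s => ∏ i ∈ Finset.range j, (W s - 1 + i) :=
    fun j => differentiable_finsetProd _ fun i _ => (hW.sub_const 1).add_const _
  induction d with
  | zero =>
    intro j hj
    exact ((isBigOOnBall_shiftedPow hW h0 h1 R j).mono hj).isSolvable.entire_mul (hprod (j + 1))
  | succ d ih =>
    intro j hj
    rcases Nat.eq_zero_or_pos K with rfl | hK
    · exact ((isSymbol_of_entire (hprod (j + 1))).mul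
        (isSymbol_shiftedPow hW h0 h1 j)).isBigOOnBall R |>.isSolvable
    obtain ⟨K, rfl⟩ : ∃ k, K = k + 1 := ⟨K - 1, by lia⟩
    obtain ⟨q, hq, hb⟩ := exists_stepOp_expansion hW h0 h1 le_rfl 1 j R (K + 1)
    have h3 := IsSolvable.sum (W := W) (δ := 1) (ζ := 1) (R := R) (K := K + 1) (Finset.range K)
      (f := fun l => (fun _ _ => (-1) ^ l / ((l + 2).factorial : ℂ)) * (fun n s =>
        (∏ i ∈ Finset.range (j + l + 1 + 1), (W s - 1 + i)) *
          shiftedPow W α ((j + l + 1 : ℕ) : ℂ) n s))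
      fun l _ => (ih (j + l + 1) (by lia)).entire_mul (differentiable_const _)
    have h4 := (hb.isSolvable (W := W) (δ := 1) (ζ := 1)).entire_mul ((hprod j).const_mul (-1))
    refine ((((isSolvable_stepOp hq).entire_mul (hprod j)).add h3).add h4).congr fun n hn s => ?_
    have e1 : ∀ l : ℕ, shiftedPow W α ((j : ℂ) - (1 : ℕ) + l + 1) n s =
        shiftedPow W α ((j + l : ℕ) : ℂ) n s := fun l => by
      congr 1; push_cast; ring
    have e2 : ∀ l : ℕ, (∏ i ∈ Finset.range j, (W s - 1 + i)) *
        binomCoeff (W s + j - (1 : ℕ)) (l + 1) =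
        (-1) ^ (l + 1) / ((l + 1).factorial : ℂ) *
          ∏ i ∈ Finset.range (j + (l + 1)), (W s - 1 + i) := fun l => by
      have : ∏ i ∈ Finset.range (l + 1), (W s - 1 + ((j + i : ℕ) : ℂ)) =
          (-1) ^ (l + 1) * ∏ i ∈ Finset.range (l + 1), -(W s + j - (1 : ℕ) + i) := by
        rw [Finset.prod_neg, Finset.card_range, ← mul_assoc, ← mul_pow]
        simp only [neg_mul_neg, one_mul, one_pow]
        exact Finset.prod_congr rfl fun i _ => by push_cast; ring
      rw [Finset.prod_range_add, this, binomCoeff]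
      have h11 : ((-1 : ℂ) ^ (l + 1)) * (-1) ^ (l + 1) = 1 := by rw [← mul_pow]; simp
      linear_combination (-(∏ i ∈ Finset.range j, (W s - 1 + i)) *
        (∏ i ∈ Finset.range (l + 1), -(W s + j - (1 : ℕ) + i)) / ((l + 1).factorial : ℂ)) * h11
    have e3 : (∏ i ∈ Finset.range j, (W s - 1 + i)) * ∑ l ∈ Finset.range (K + 1),
        binomCoeff (W s + j - (1 : ℕ)) (l + 1) *
          shiftedPow W α ((j : ℂ) - (1 : ℕ) + l + 1) n s =
        ∑ l ∈ Finset.range K, (-1) ^ l / ((l + 2).factorial : ℂ) *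
          ((∏ i ∈ Finset.range (j + l + 1 + 1), (W s - 1 + i)) *
            shiftedPow W α ((j + l + 1 : ℕ) : ℂ) n s) -
        (∏ i ∈ Finset.range (j + 1), (W s - 1 + i)) * shiftedPow W α j n s := by
      simp only [e1, Finset.mul_sum, ← mul_assoc, e2]
      rw [Finset.sum_range_succ']
      refine (congrArg₂ (fun x y : ℂ => x + y) (Finset.sum_congr rfl fun l _ => ?_) ?_).trans
        (sub_eq_add_neg _ _).symm
      · rw [show j + l + 1 = j + (l + 1) by ring, show j + (l + 1 + 1) = j + (l + 1) + 1 by ring,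
          pow_succ, pow_succ]
        ring
      · simp
    simp only [Pi.mul_apply, Pi.add_apply, Finset.sum_apply]
    linear_combination (-1 : ℂ) * e3

/-- Iterated functional equation of the reciprocal Gamma function. -/
theorem inv_Gamma_eq_prod_mul (z : ℂ) (j : ℕ) : (Complex.Gamma z)⁻¹ =
    (∏ i ∈ Finset.range j, (z + i)) * (Complex.Gamma (z + j))⁻¹ := by
  induction j with
  | zero => simp
  | succ j ih =>
    rw [ih, Finset.prod_range_succ, Complex.one_div_Gamma_eq_self_mul_one_div_Gamma_add_one]
    push_cast
    rw [add_assoc]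
    ring

/-- The factor `1 / Γ(W - 1)` contains all the multipliers `(W - 1) W ⋯ (W + j - 1)`, so that it
makes the difference equation solvable for every symbol when `ζ = 1`. -/
theorem IsSymbol.isSolvable_inv_Gamma_mul [ProperSpace E] (hW : Differentiable ℂ W)
    (hh : IsSymbol h) (R : ℝ) (K : ℕ) :
    IsSolvable W 1 1 R K ((fun _ s => (Complex.Gamma (W s - 1))⁻¹) * h) := by
  have hΓ : ∀ j : ℕ, Differentiable ℂ fun s => (Complex.Gamma (W s - 1 + j))⁻¹ := fun j =>
    Complex.differentiable_one_div_Gamma.comp ((hW.sub_const 1).add_const _)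
  have hΓ0 : Differentiable ℂ fun s => (Complex.Gamma (W s - 1))⁻¹ := by simpa using hΓ 0
  obtain ⟨p, hp, hb⟩ := hh.exists_approx R K
  have hps : IsSolvable W 1 1 R K ((fun _ s => (Complex.Gamma (W s - 1))⁻¹) * p) := by
    clear hb
    induction hp using AddSubmonoid.closure_induction with
    | mem x hx =>
      obtain ⟨c, k, hc, rfl⟩ := hx
      refine ((isSolvable_shiftedPow hW le_rfl zero_le_one R K K k (by lia)).entire_mul
        (hc.mul (hΓ (k + 1)))).congr fun n hn s => ?_
      simp only [Pi.mul_apply]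
      rw [shiftedPow_zero hn, inv_Gamma_eq_prod_mul (W s - 1) (k + 1)]
      ring
    | zero =>
      rw [mul_zero]
      exact (isBigOOnBall_zero R K).isSolvable
    | add x y _ _ h1 h2 => rw [mul_add]; exact h1.add h2
  have := (hb.isSolvable.entire_mul (W := W) (δ := 1) (ζ := 1) hΓ0).add hps
  rwa [← mul_add, sub_add_cancel] at this

end DifferenceEquation

/-! ### Tails of twisted series of symbols -/

section Tails

variable {E : Type*} [NormedAddCommGroup E] [NormedSpace ℂ E]
  {W : E → ℂ} {δ : ℕ} {ζ : ℂ} {h : ℕ → E → ℂ}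

theorem norm_natCast_cpow_le {m : ℕ} (hm : 1 ≤ m) {z : ℂ} {ρ : ℕ} (hz : z.re ≤ ρ) :
    ‖(m : ℂ) ^ z‖ ≤ (m : ℝ) ^ ρ := by
  rw [Complex.norm_natCast_cpow_of_pos (by lia), ← Real.rpow_natCast]
  exact Real.rpow_le_rpow_of_exponent_le (by exact_mod_cast hm) hz

theorem summable_tail_of_one_lt_re [ProperSpace E] (hζ : ‖ζ‖ = 1) (hh : IsSymbol h) {s : E}
    (hs : 1 < (W s).re) {n : ℕ} (hn : 1 ≤ n) :
    Summable fun k => ζ ^ (n + k) * ((n + k : ℕ) : ℂ) ^ (-W s) * h (n + k) s := by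
  obtain ⟨C, hC⟩ := hh.isBigOOnBall ‖s‖
  have h1 : Summable fun m : ℕ => (m : ℝ) ^ (-(W s).re) := Real.summable_nat_rpow.2 (by linarith)
  refine Summable.of_norm_bounded (((summable_nat_add_iff n).2 h1).mul_right C) fun k => ?_
  rw [norm_mul, norm_mul, norm_pow, hζ, one_pow, one_mul,
    Complex.norm_natCast_cpow_of_pos (by lia), Complex.neg_re, add_comm k n]
  have := hC (n + k) (by lia) s le_rfl
  rw [pow_zero, mul_one] at this
  gcongr

/-- The tail of a series of symbols on a ball: if the difference equation is solved up to
`O(n ^ (-K'))` with `K'` large, then the error term contributes a series which converges on the whole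
ball, and the rest telescopes. -/
theorem exists_tail_on_ball [ProperSpace E] (hW : Differentiable ℂ W) (hδ : δ ≤ 1) (hζ : ‖ζ‖ = 1)
    (hh : IsSymbol h) (hsol : ∀ R K, IsSolvable W δ ζ R K h) (R : ℝ) (K : ℕ) :
    ∃ q g : ℕ → E → ℂ, IsSymbol q ∧ (∀ n, 1 ≤ n → DifferentiableOn ℂ (g n) (Metric.ball 0 R)) ∧
      IsBigOOnBall R K (g - q) ∧ ∀ n, 1 ≤ n → ∀ s, ‖s‖ ≤ R → 1 < (W s).re →
        HasSum (fun k => ζ ^ (n + k) * ((n + k : ℕ) : ℂ) ^ (-W s) * h (n + k) s)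
          (ζ ^ n * (n : ℂ) ^ (δ - W s) * g n s) := by
  have hζ0 : ζ ≠ 0 := norm_ne_zero_iff.1 (by rw [hζ]; exact one_ne_zero)
  obtain ⟨ρ, hρ⟩ := exists_norm_le_of_differentiable hW R
  have hre : ∀ s : E, ‖s‖ ≤ R → |(W s).re| ≤ ρ := fun s hs =>
    (Complex.abs_re_le_norm _).trans (hρ s hs)
  obtain ⟨q, hq, hb⟩ := hsol R (K + 2 * ρ + 2)
  obtain ⟨C, hC0, hC⟩ := hb.nonneg
  set D : ℕ → E → ℂ := fun m s => ζ ^ m * (m : ℂ) ^ (-W s) * (h - stepOp W δ ζ q) m s with hD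
  have hcast : ∀ m : ℕ, 1 ≤ m → (m : ℂ) ≠ 0 := fun m hm => by exact_mod_cast (by lia : m ≠ 0)
  have hDdiff : ∀ m, 1 ≤ m → Differentiable ℂ (D m) := fun m hm => by
    have hm0 := hcast m hm
    have hm1 := hcast (m + 1) (by lia)
    have d1 : Differentiable ℂ fun s => (m : ℂ) ^ (-W s) := hW.neg.const_cpow (Or.inl hm0)
    have d2 : Differentiable ℂ fun s => (m : ℂ) ^ W s := hW.const_cpow (Or.inl hm0)
    have d3 : Differentiable ℂ fun s => (m : ℂ) ^ (δ - W s) :=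
      (hW.const_sub _).const_cpow (Or.inl hm0)
    have d4 : Differentiable ℂ fun s => ((m + 1 : ℕ) : ℂ) ^ (δ - W s) :=
      (hW.const_sub _).const_cpow (Or.inl hm1)
    exact (d1.const_mul _).mul ((hh.differentiable m hm).sub (d2.mul
      ((d3.mul (hq.differentiable m hm)).sub
        ((d4.const_mul ζ).mul (hq.differentiable (m + 1) (by lia))))))
  have hDle : ∀ n, 1 ≤ n → ∀ k s, ‖s‖ ≤ R →
      ‖D (n + k) s‖ ≤ C * ((n : ℝ)⁻¹) ^ (K + ρ) * (((k + 1 : ℕ) : ℝ)⁻¹) ^ 2 := by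
    intro n hn k s hs
    have hm : 1 ≤ n + k := by lia
    have hnr : (0 : ℝ) < n := by exact_mod_cast hn
    have hmr : (0 : ℝ) < (n + k : ℕ) := by exact_mod_cast hm
    have h1 := hC (n + k) hm s hs
    have h2 : ‖((n + k : ℕ) : ℂ) ^ (-W s)‖ ≤ ((n + k : ℕ) : ℝ) ^ ρ := by
      refine norm_natCast_cpow_le hm ?_
      rw [Complex.neg_re]
      linarith [(abs_le.1 (hre s hs)).1]
    have i1 : (((n + k : ℕ) : ℝ))⁻¹ ≤ (n : ℝ)⁻¹ :=
      inv_anti₀ hnr (by exact_mod_cast Nat.le_add_right n k)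
    have i2 : (((n + k : ℕ) : ℝ))⁻¹ ≤ ((k + 1 : ℕ) : ℝ)⁻¹ :=
      inv_anti₀ (by positivity) (by exact_mod_cast (by lia : k + 1 ≤ n + k))
    calc ‖D (n + k) s‖ = ‖((n + k : ℕ) : ℂ) ^ (-W s)‖ * ‖(h - stepOp W δ ζ q) (n + k) s‖ := by
          rw [hD]; simp [hζ]
      _ ≤ ((n + k : ℕ) : ℝ) ^ ρ * (C * (((n + k : ℕ) : ℝ)⁻¹) ^ (K + 2 * ρ + 2)) :=
          mul_le_mul h2 h1 (norm_nonneg _) (by positivity)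
      _ = C * (((n + k : ℕ) : ℝ)⁻¹) ^ (K + ρ) * (((n + k : ℕ) : ℝ)⁻¹) ^ 2 := by
          rw [show K + 2 * ρ + 2 = ρ + (K + ρ) + 2 by ring, pow_add, pow_add, inv_pow _ ρ]
          field_simp
      _ ≤ _ := by gcongr
  have hsum2 : Summable fun k : ℕ => (((k + 1 : ℕ) : ℝ)⁻¹) ^ 2 := by
    simp_rw [inv_pow]
    exact (summable_nat_add_iff 1).2 (Real.summable_nat_pow_inv.2 (by norm_num))
  have hDsum : ∀ n, 1 ≤ n → ∀ s, ‖s‖ ≤ R → Summable fun k => D (n + k) s := fun n hn s hs =>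
    Summable.of_norm_bounded (hsum2.mul_left _) fun k => hDle n hn k s hs
  refine ⟨q, fun n s => q n s + (ζ ^ n)⁻¹ * (n : ℂ) ^ (W s - δ) * ∑' k, D (n + k) s, hq, ?_, ?_, ?_⟩
  · intro n hn
    have d1 : Differentiable ℂ fun s => (n : ℂ) ^ (W s - δ) :=
      (hW.sub_const _).const_cpow (Or.inl (hcast n hn))
    refine (hq.differentiable n hn).differentiableOn.add
      ((d1.const_mul _).differentiableOn.mul ?_)
    refine differentiableOn_tsum_of_norm_le (hsum2.mul_left (C * ((n : ℝ)⁻¹) ^ (K + ρ)))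
      Metric.isOpen_ball (fun k => (hDdiff (n + k) (by lia)).differentiableOn) fun k s hs => ?_
    exact hDle n hn k s (by simpa using (Metric.mem_ball.1 hs).le)
  · refine ⟨C * ∑' k : ℕ, (((k + 1 : ℕ) : ℝ)⁻¹) ^ 2, fun n hn s hs => ?_⟩
    have hnr : (n : ℝ) ≠ 0 := by exact_mod_cast (by lia : n ≠ 0)
    have h1 : ‖∑' k, D (n + k) s‖ ≤
        ∑' k : ℕ, C * ((n : ℝ)⁻¹) ^ (K + ρ) * (((k + 1 : ℕ) : ℝ)⁻¹) ^ 2 :=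
      tsum_of_norm_bounded (hsum2.mul_left _).hasSum fun k => hDle n hn k s hs
    rw [tsum_mul_left] at h1
    have h2 : ‖(n : ℂ) ^ (W s - δ)‖ ≤ (n : ℝ) ^ ρ := by
      refine norm_natCast_cpow_le hn ?_
      rw [Complex.sub_re, Complex.natCast_re]
      linarith [(abs_le.1 (hre s hs)).2, (Nat.cast_nonneg δ : (0 : ℝ) ≤ δ)]
    simp only [Pi.sub_apply, add_sub_cancel_left]
    rw [norm_mul, norm_mul, norm_inv, norm_pow, hζ, one_pow, inv_one, one_mul]
    refine (mul_le_mul h2 h1 (norm_nonneg _) (by positivity)).trans (le_of_eq ?_)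
    rw [pow_add, inv_pow _ ρ]
    field_simp
  · intro n hn s hs hs1
    set v : ℕ → ℂ := fun m => ζ ^ m * (m : ℂ) ^ (δ - W s) * q m s with hv
    have hA := summable_tail_of_one_lt_re hζ hh hs1 hn
    have hAv : ∀ k, ζ ^ (n + k) * ((n + k : ℕ) : ℂ) ^ (-W s) * h (n + k) s - D (n + k) s =
        v (n + k) - v (n + k + 1) := fun k => by
      have e : ((n + k : ℕ) : ℂ) ^ (-W s) * ((n + k : ℕ) : ℂ) ^ W s = 1 := by
        rw [← Complex.cpow_add _ _ (hcast _ (by lia))]; simp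
      simp only [hD, hv, stepOp, Pi.sub_apply, pow_succ]
      linear_combination (ζ ^ (n + k) * (((n + k : ℕ) : ℂ) ^ (δ - W s) * q (n + k) s -
        ζ * ((n + k + 1 : ℕ) : ℂ) ^ (δ - W s) * q (n + k + 1) s)) * e
    have hv0 : Tendsto (fun k => v (n + k)) atTop (𝓝 0) := by
      obtain ⟨M, hM0, hM⟩ := (hq.isBigOOnBall R).nonneg
      have hlim : Tendsto (fun k : ℕ => ((n + k : ℕ) : ℝ) ^ (-((W s).re - 1)) * M) atTop (𝓝 0) := by
        have := (tendsto_rpow_neg_atTop (sub_pos.2 hs1)).comp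
          (tendsto_natCast_atTop_atTop.comp (tendsto_add_atTop_nat n))
        simpa [Function.comp_def, add_comm] using this.mul_const M
      refine squeeze_zero_norm (fun k => ?_) hlim
      have hm : 1 ≤ n + k := by lia
      rw [hv, norm_mul, norm_mul, norm_pow, hζ, one_pow, one_mul,
        Complex.norm_natCast_cpow_of_pos (by lia)]
      refine mul_le_mul ?_ (by simpa using hM _ hm s hs) (norm_nonneg _) (by positivity)
      refine Real.rpow_le_rpow_of_exponent_le (by exact_mod_cast hm) ?_
      have : (δ : ℝ) ≤ 1 := by exact_mod_cast hδ
      rw [Complex.sub_re, Complex.natCast_re]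
      linarith
    have hB : HasSum (fun k => ζ ^ (n + k) * ((n + k : ℕ) : ℂ) ^ (-W s) * h (n + k) s -
        D (n + k) s) (v n) := by
      rw [(hA.sub (hDsum n hn s hs)).hasSum_iff_tendsto_nat]
      have hpart : ∀ N, ∑ k ∈ Finset.range N, (ζ ^ (n + k) * ((n + k : ℕ) : ℂ) ^ (-W s) *
          h (n + k) s - D (n + k) s) = v n - v (n + N) := fun N => by
        rw [Finset.sum_congr rfl fun k _ => hAv k]
        exact Finset.sum_range_sub' (fun k => v (n + k)) N
      simp only [hpart]
      simpa using hv0.const_sub (v n)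
    have := hB.add (hDsum n hn s hs).hasSum
    simp only [sub_add_cancel] at this
    convert this using 1
    have e : (n : ℂ) ^ (δ - W s) * (n : ℂ) ^ (W s - δ) = 1 := by
      rw [← Complex.cpow_add _ _ (hcast n hn)]; simp
    have e' : ζ ^ n * (ζ ^ n)⁻¹ = 1 := mul_inv_cancel₀ (pow_ne_zero n hζ0)
    simp only [hv]
    linear_combination (∑' k, D (n + k) s) * (ζ ^ n * (ζ ^ n)⁻¹ * e + e')

/-- The tail of a series of symbols is a symbol, provided that the difference equation is solvable
to all orders; the holomorphic continuations obtained on balls are unique and therefore glue. -/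
theorem exists_isSymbol_tail [ProperSpace E] (hW : Differentiable ℂ W) (hW1 : ∃ s, 1 < (W s).re)
    (hδ : δ ≤ 1) (hζ : ‖ζ‖ = 1) (hh : IsSymbol h) (hsol : ∀ R K, IsSolvable W δ ζ R K h) :
    ∃ G : ℕ → E → ℂ, IsSymbol G ∧ ∀ s, 1 < (W s).re → ∀ n, 1 ≤ n →
        HasSum (fun k => ζ ^ (n + k) * ((n + k : ℕ) : ℂ) ^ (-W s) * h (n + k) s)
          (ζ ^ n * (n : ℂ) ^ (δ - W s) * G n s) := by
  have hζ0 : ζ ≠ 0 := norm_ne_zero_iff.1 (by rw [hζ]; exact one_ne_zero)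
  obtain ⟨a, ha⟩ := hW1
  set Ω : Set E := {s | 1 < (W s).re} with hΩdef
  have hΩ : IsOpen Ω :=
    isOpen_lt continuous_const (Complex.continuous_re.comp hW.continuous)
  set T : ℕ → E → ℂ := fun n s => (ζ ^ n * (n : ℂ) ^ (δ - W s))⁻¹ *
    ∑' k, ζ ^ (n + k) * ((n + k : ℕ) : ℂ) ^ (-W s) * h (n + k) s with hT
  have hne : ∀ n : ℕ, 1 ≤ n → ∀ s, ζ ^ n * (n : ℂ) ^ (δ - W s) ≠ 0 := fun n hn s => by
    have hn0 : (n : ℂ) ≠ 0 := by exact_mod_cast (by lia : n ≠ 0)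
    exact mul_ne_zero (pow_ne_zero _ hζ0) (by simp [Complex.cpow_eq_zero_iff, hn0])
  have hTg : ∀ n, 1 ≤ n → ∀ s x, HasSum (fun k => ζ ^ (n + k) * ((n + k : ℕ) : ℂ) ^ (-W s) *
      h (n + k) s) (ζ ^ n * (n : ℂ) ^ (δ - W s) * x) → x = T n s := fun n hn s x hx => by
    rw [hT]
    simp only
    rw [hx.tsum_eq, inv_mul_cancel_left₀ (hne n hn s)]
  choose q g hq hg hgq hgs using
    fun (R : ℝ) (K : ℕ) => exists_tail_on_ball hW hδ hζ hh hsol R K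
  have hgT : ∀ R K n, 1 ≤ n → ∀ s ∈ Metric.ball (0 : E) R, s ∈ Ω → g R K n s = T n s :=
    fun R K n hn s hs hs1 => hTg n hn s _
      (hgs R K n hn s (by simpa using (Metric.mem_ball.1 hs).le) hs1)
  have hex : ∀ n : ℕ, 1 ≤ n → _ := fun n hn =>
    exists_entire_of_forall_ball hΩ (a := a) ha (T := T n)
      fun R _ => ⟨g R 0 n, hg R 0 n hn, hgT R 0 n hn⟩
  choose! G hGd hGT hGu using hex
  refine ⟨G, ⟨hGd, fun R K => ?_⟩, fun s hs n hn => ?_⟩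
  · set R' : ℝ := max R ‖a‖ + 1
    have haR : ‖a‖ < R' := (le_max_right _ _).trans_lt (lt_add_one _)
    have hRR : R < R' := (le_max_left _ _).trans_lt (lt_add_one _)
    obtain ⟨p, hp, hb⟩ := (hq R' K).exists_approx R K
    refine ⟨p, hp, (((hgq R' K).mono_ball hRR.le).add hb).congr fun n hn s hs => ?_⟩
    have := hGu n hn R' haR _ (hg R' K n hn) (hgT R' K n hn) s (by simpa using hs.trans_lt hRR)
    simp only [Pi.add_apply, Pi.sub_apply, this]
    ring
  · rw [hGT n hn s hs, hT]
    simp only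
    rw [mul_inv_cancel_left₀ (hne n hn s)]
    exact (summable_tail_of_one_lt_re hζ hh hs hn).hasSum

end Tails

/-! ### Iterated sums -/

section IteratedSums

/-- The iterated sum `∑_{n_l > n} a_{l-1}(n_l) ∑_{n_{l-1} > n_l} ⋯ ∑_{n_1 > n_2} a_0(n_1)`. -/
noncomputable def tailSum {M : Type*} [Semiring M] [TopologicalSpace M] (a : ℕ → ℕ → M) :
    ℕ → ℕ → M
  | 0, _ => 1
  | l + 1, n => ∑' k, a l (n + 1 + k) * tailSum a l (n + 1 + k)

/-- The tuples `n_1 > ⋯ > n_l > n`. -/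
def TailIndex (l n : ℕ) : Type := {x : Fin l → ℕ // StrictAnti x ∧ ∀ j, n < x j}

/-- Adjoining the smallest entry `n + 1 + k` to a tuple. -/
def TailIndex.snoc (l n : ℕ) (p : Σ k : ℕ, TailIndex l (n + 1 + k)) : TailIndex (l + 1) n :=
  ⟨Fin.snoc (α := fun _ => ℕ) p.2.1 (n + 1 + p.1), by
    obtain ⟨k, y, hy, hy'⟩ := p
    constructor
    · intro i j hij
      induction j using Fin.lastCases with
      | last =>
        induction i using Fin.lastCases with
        | last => exact absurd hij (lt_irrefl _)
        | cast i => simpa using hy' i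
      | cast j =>
        induction i using Fin.lastCases with
        | last => exact absurd hij (not_lt.2 (Fin.le_last _))
        | cast i => simpa using hy (by simpa using hij)
    · intro j
      induction j using Fin.lastCases with
      | last => simp only [Fin.snoc_last]; lia
      | cast j =>
        have := hy' j
        simp only [Fin.snoc_castSucc]; lia⟩

theorem TailIndex.snoc_bijective (l n : ℕ) : Function.Bijective (TailIndex.snoc l n) := by
  constructor
  · rintro ⟨k, y, hy⟩ ⟨k', y', hy'⟩ h
    have hfun := congrArg Subtype.val h
    have hk : k = k' := by
      simpa [TailIndex.snoc] using congrFun hfun (Fin.last l)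
    subst hk
    have hyy : y = y' := by
      funext j
      simpa [TailIndex.snoc] using congrFun hfun j.castSucc
    subst hyy
    rfl
  · intro x
    have hlast := x.2.2 (Fin.last l)
    refine ⟨⟨x.1 (Fin.last l) - (n + 1), fun j => x.1 j.castSucc, ?_, ?_⟩, ?_⟩
    · intro i j hij
      exact x.2.1 (by simpa using hij)
    · intro j
      have h2 := x.2.1 (Fin.castSucc_lt_last j)
      lia
    · apply Subtype.ext
      funext j
      induction j using Fin.lastCases with
      | last => simp only [TailIndex.snoc, Fin.snoc_last]; lia
      | cast j => simp [TailIndex.snoc]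

/-- If the iterated sum of the norms converges at each stage, then the multiple series converges
absolutely and agrees with the iterated sum. -/
theorem summable_prod_and_tsum_eq_tailSum (a : ℕ → ℕ → ℂ) (r : ℕ)
    (ha : ∀ l < r, ∀ n, Summable fun k =>
      ‖a l (n + 1 + k)‖ * tailSum (fun j m => ‖a j m‖) l (n + 1 + k)) :
    ∀ l ≤ r, ∀ n, Summable (fun x : TailIndex l n => ∏ j : Fin l, ‖a j (x.1 j)‖) ∧
      ∑' x : TailIndex l n, ∏ j : Fin l, ‖a j (x.1 j)‖ = tailSum (fun j m => ‖a j m‖) l n ∧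
      ∑' x : TailIndex l n, ∏ j : Fin l, a j (x.1 j) = tailSum a l n := by
  intro l
  induction l with
  | zero =>
    intro _ n
    have : Unique (TailIndex 0 n) :=
      { default := ⟨Fin.elim0, fun i => i.elim0, fun i => i.elim0⟩
        uniq := fun x => Subtype.ext (funext fun i => i.elim0) }
    refine ⟨Summable.of_finite, ?_, ?_⟩ <;> simp [tailSum, tsum_fintype]
  | succ l ih =>
    intro hl n
    have ih' := ih (by lia)
    have hterm : ∀ p : (Σ k : ℕ, TailIndex l (n + 1 + k)),
        ∏ j : Fin (l + 1), a j ((TailIndex.snoc l n p).1 j) =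
          a l (n + 1 + p.1) * ∏ j : Fin l, a j (p.2.1 j) := fun p => by
      rw [Fin.prod_univ_castSucc, mul_comm]
      simp [TailIndex.snoc]
    have hnorm : ∀ p : (Σ k : ℕ, TailIndex l (n + 1 + k)),
        ∏ j : Fin (l + 1), ‖a j ((TailIndex.snoc l n p).1 j)‖ =
          ‖a l (n + 1 + p.1)‖ * ∏ j : Fin l, ‖a j (p.2.1 j)‖ := fun p => by
      simpa only [norm_mul, norm_prod] using congrArg norm (hterm p)
    have hsum : Summable fun p : (Σ k : ℕ, TailIndex l (n + 1 + k)) =>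
        ‖a l (n + 1 + p.1)‖ * ∏ j : Fin l, ‖a j (p.2.1 j)‖ := by
      refine (summable_sigma_of_nonneg fun p => mul_nonneg (norm_nonneg _)
        (Finset.prod_nonneg fun j _ => norm_nonneg _)).2 ⟨fun k => (ih' (n + 1 + k)).1.mul_left ‖a l (n + 1 + k)‖, ?_⟩
      simp only [tsum_mul_left, (ih' _).2.1]
      exact ha l (by lia) n
    have hsumc : Summable fun p : (Σ k : ℕ, TailIndex l (n + 1 + k)) =>
        a l (n + 1 + p.1) * ∏ j : Fin l, a j (p.2.1 j) :=
      Summable.of_norm (by simpa only [norm_mul, norm_prod] using hsum)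
    let e := Equiv.ofBijective _ (TailIndex.snoc_bijective l n)
    refine ⟨?_, ?_, ?_⟩
    · rw [← e.summable_iff]
      simpa only [e, Function.comp_def, Equiv.ofBijective_apply, hnorm] using hsum
    · rw [← e.tsum_eq]
      simp only [e, Equiv.ofBijective_apply, hnorm]
      rw [hsum.tsum_sigma]
      simp only [tsum_mul_left, (ih' _).2.1, tailSum]
    · rw [← e.tsum_eq]
      simp only [e, Equiv.ofBijective_apply, hterm]
      rw [hsumc.tsum_sigma]
      simp only [tsum_mul_left, (ih' _).2.2, tailSum]

/-- Convergence of the iterated sums of norms when `a_j(m) = O(m ^ (-σ_j))` and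
`σ_0 + ⋯ + σ_{l-1} > l` for `1 ≤ l ≤ r`. The strict inequalities leave room for a loss of `m ^ ε` in
each summation. -/
theorem summable_norm_mul_tailSum (a : ℕ → ℕ → ℂ) (σ : ℕ → ℝ) (r : ℕ)
    (ha : ∀ j < r, ∃ C : ℝ, ∀ m : ℕ, 1 ≤ m → ‖a j m‖ ≤ C * (m : ℝ) ^ (-σ j))
    (hσ : ∀ l : ℕ, 1 ≤ l → l ≤ r → (l : ℝ) < ∑ j ∈ Finset.range l, σ j) :
    ∀ l < r, ∀ n, Summable fun k =>
      ‖a l (n + 1 + k)‖ * tailSum (fun j m => ‖a j m‖) l (n + 1 + k) := by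
  obtain ⟨ε, hε, hε'⟩ : ∃ ε : ℝ, 0 < ε ∧ ∀ l ∈ Finset.Icc 1 r,
      (l : ℝ) * (1 + ε) < ∑ j ∈ Finset.range l, σ j := by
    have : ∀ᶠ ε in 𝓝[>] (0 : ℝ), ∀ l ∈ Finset.Icc 1 r,
        (l : ℝ) * (1 + ε) < ∑ j ∈ Finset.range l, σ j := by
      rw [Filter.eventually_all_finset]
      intro l hl
      rw [Finset.mem_Icc] at hl
      have hc : Tendsto (fun ε : ℝ => (l : ℝ) * (1 + ε)) (𝓝[>] 0) (𝓝 (l * (1 + 0))) :=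
        Tendsto.mono_left (Continuous.tendsto (by fun_prop) 0) nhdsWithin_le_nhds
      exact hc.eventually_lt_const (by simpa using hσ l hl.1 hl.2)
    obtain ⟨ε, h1, h2⟩ := (this.and self_mem_nhdsWithin).exists
    exact ⟨ε, h2, h1⟩
  set B := tailSum (fun j m => ‖a j m‖) with hB
  have hZ : Summable fun k : ℕ => ((k + 1 : ℕ) : ℝ) ^ (-(1 + ε)) :=
    (summable_nat_add_iff 1).2 (Real.summable_nat_rpow.2 (by linarith))
  have hZ0 : 0 ≤ ∑' k : ℕ, ((k + 1 : ℕ) : ℝ) ^ (-(1 + ε)) := tsum_nonneg fun k => by positivity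
  have hBnn : ∀ l n, 0 ≤ B l n := by
    intro l
    induction l with
    | zero => intro n; simp [hB, tailSum]
    | succ l ih => intro n; exact tsum_nonneg fun k => mul_nonneg (norm_nonneg _) (ih _)
  -- the bound for one summation: for `m = n + 1 + k`, and for every `N` with `1 ≤ N ≤ m`
  have hstep : ∀ l < r, ∀ C : ℝ, (∀ m : ℕ, 1 ≤ m →
      B l m ≤ C * (m : ℝ) ^ (-(∑ j ∈ Finset.range l, σ j - l * (1 + ε)))) →
      ∃ C' : ℝ, 0 ≤ C' ∧ ∀ n N k : ℕ, 1 ≤ N → N ≤ n + 1 →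
        ‖a l (n + 1 + k)‖ * B l (n + 1 + k) ≤ C' * (N : ℝ) ^
          (-(∑ j ∈ Finset.range (l + 1), σ j - (l + 1 : ℕ) * (1 + ε))) *
            ((k + 1 : ℕ) : ℝ) ^ (-(1 + ε)) := by
    intro l hl C hC
    obtain ⟨A, hA⟩ := ha l hl
    have hA0 : 0 ≤ A := by simpa using (norm_nonneg _).trans (hA 1 le_rfl)
    have hC0 : 0 ≤ C := by simpa using (hBnn l 1).trans (hC 1 le_rfl)
    refine ⟨A * C, by positivity, fun n N k hN hNn => ?_⟩
    have hm : 1 ≤ n + 1 + k := by lia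
    have hNr : (0 : ℝ) < N := by exact_mod_cast hN
    have hmr : (0 : ℝ) < (n + 1 + k : ℕ) := by exact_mod_cast hm
    set κ : ℝ := ∑ j ∈ Finset.range (l + 1), σ j - (l + 1 : ℕ) * (1 + ε) with hκ
    have hκ0 : 0 ≤ κ := by
      have := hε' (l + 1) (Finset.mem_Icc.2 ⟨by lia, hl⟩)
      rw [hκ]; linarith
    have e1 : ((n + 1 + k : ℕ) : ℝ) ^ (-σ l) * ((n + 1 + k : ℕ) : ℝ) ^
        (-(∑ j ∈ Finset.range l, σ j - l * (1 + ε))) =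
        ((n + 1 + k : ℕ) : ℝ) ^ (-κ) * ((n + 1 + k : ℕ) : ℝ) ^ (-(1 + ε)) := by
      rw [← Real.rpow_add hmr, ← Real.rpow_add hmr, hκ, Finset.sum_range_succ]
      congr 1
      push_cast
      ring
    calc ‖a l (n + 1 + k)‖ * B l (n + 1 + k)
        ≤ (A * ((n + 1 + k : ℕ) : ℝ) ^ (-σ l)) * (C * ((n + 1 + k : ℕ) : ℝ) ^
          (-(∑ j ∈ Finset.range l, σ j - l * (1 + ε)))) :=
          mul_le_mul (hA _ hm) (hC _ hm) (hBnn _ _) (by positivity)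
      _ = A * C * (((n + 1 + k : ℕ) : ℝ) ^ (-κ) * ((n + 1 + k : ℕ) : ℝ) ^ (-(1 + ε))) := by
          rw [← e1]; ring
      _ ≤ A * C * ((N : ℝ) ^ (-κ) * ((k + 1 : ℕ) : ℝ) ^ (-(1 + ε))) := by
          have i1 : ((n + 1 + k : ℕ) : ℝ) ^ (-κ) ≤ (N : ℝ) ^ (-κ) :=
            Real.rpow_le_rpow_of_nonpos hNr (by exact_mod_cast (by lia : N ≤ n + 1 + k))
              (by linarith)
          have i2 : ((n + 1 + k : ℕ) : ℝ) ^ (-(1 + ε)) ≤ ((k + 1 : ℕ) : ℝ) ^ (-(1 + ε)) :=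
            Real.rpow_le_rpow_of_nonpos (by positivity)
              (by exact_mod_cast (by lia : k + 1 ≤ n + 1 + k)) (by linarith)
          gcongr
      _ = _ := by ring
  have hbound : ∀ l ≤ r, ∃ C : ℝ, ∀ m : ℕ, 1 ≤ m →
      B l m ≤ C * (m : ℝ) ^ (-(∑ j ∈ Finset.range l, σ j - l * (1 + ε))) := by
    intro l
    induction l with
    | zero => exact fun _ => ⟨1, fun m _ => by simp [hB, tailSum]⟩
    | succ l ih =>
      intro hl
      obtain ⟨C, hC⟩ := ih (by lia)
      obtain ⟨C', hC'0, hC'⟩ := hstep l hl C hC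
      refine ⟨C' * ∑' k : ℕ, ((k + 1 : ℕ) : ℝ) ^ (-(1 + ε)), fun m hm => ?_⟩
      have hle := fun k => hC' m m k hm (by lia)
      have hs := hZ.mul_left (C' * (m : ℝ) ^
          (-(∑ j ∈ Finset.range (l + 1), σ j - (l + 1 : ℕ) * (1 + ε))))
      have hs' := Summable.of_nonneg_of_le
        (fun k => mul_nonneg (norm_nonneg (a l (m + 1 + k))) (hBnn l _)) hle hs
      have := hs'.tsum_le_tsum hle hs
      rw [tsum_mul_left] at this
      refine this.trans (le_of_eq ?_)
      ring
  intro l hl n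
  obtain ⟨C, hC⟩ := hbound l hl.le
  obtain ⟨C', hC'0, hC'⟩ := hstep l hl C hC
  exact Summable.of_nonneg_of_le (fun k => mul_nonneg (norm_nonneg _) (hBnn l _))
    (fun k => hC' n 1 k le_rfl (by lia)) (hZ.mul_left _)

end IteratedSums

/-! ### The inner sums of the multiple Lerch series -/

section Lerch

variable {r : ℕ}

/-- The `j`-th entry of a tuple, extended by zero to all `j : ℕ`. -/
def coord {M : Type*} [Zero M] (v : Fin r → M) (j : ℕ) : M := if h : j < r then v ⟨j, h⟩ else 0

theorem partialSum_eq_sum_coord {M : Type*} [AddCommMonoid M] (v : Fin r → M) (l : ℕ) :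
    partialSum v l = ∑ j ∈ Finset.range l, coord v j := by
  have h1 : partialSum v l =
      ∑ j : Fin r, if (j : ℕ) < l then coord v j else 0 := by
    rw [partialSum, Finset.sum_filter]
    exact Finset.sum_congr rfl fun j _ => by simp [coord]
  rw [h1, Fin.sum_univ_eq_sum_range (fun j => if j < l then coord v j else 0), ← Finset.sum_filter]
  have h2 : (Finset.range r).filter (· < l) = (Finset.range l).filter (· < r) := by
    ext j; simp [and_comm]
  rw [h2, Finset.sum_filter]
  refine Finset.sum_congr rfl fun j _ => ?_
  split_ifs with h
  · rfl
  · simp [coord, h]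

theorem partialSum_zero {M : Type*} [AddCommMonoid M] (v : Fin r → M) : partialSum v 0 = 0 := by
  simp [partialSum]

theorem partialSum_succ {M : Type*} [AddCommMonoid M] (v : Fin r → M) (l : ℕ) :
    partialSum v (l + 1) = partialSum v l + coord v l := by
  simp only [partialSum_eq_sum_coord, Finset.sum_range_succ]

theorem differentiable_coord (j : ℕ) : Differentiable ℂ fun s : Fin r → ℂ => coord s j := by
  by_cases h : j < r
  · simp only [coord, h, dif_pos]; fun_prop
  · simp [coord, h]

theorem differentiable_partialSum (l : ℕ) :
    Differentiable ℂ fun s : Fin r → ℂ => partialSum s l := by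
  unfold partialSum
  fun_prop

theorem coord_mem_Ico {α : Fin r → ℝ} (hα : ∀ j, α j ∈ Set.Ico (0 : ℝ) 1) (j : ℕ) :
    coord α j ∈ Set.Ico (0 : ℝ) 1 := by
  by_cases h : j < r
  · simpa [coord, h] using hα ⟨j, h⟩
  · simp [coord, h]

theorem norm_e (a : ℝ) : ‖e a‖ = 1 := by
  rw [e, show (2 * Real.pi * Complex.I * a : ℂ) = ((2 * Real.pi * a : ℝ) : ℂ) * Complex.I by
    push_cast; ring]
  exact Complex.norm_exp_ofReal_mul_I _

theorem e_add (a b : ℝ) : e (a + b) = e a * e b := by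
  rw [e, e, e, ← Complex.exp_add]; push_cast; ring_nf

theorem e_zero : e 0 = 1 := by simp [e]

theorem e_mul_natCast (a : ℝ) (n : ℕ) : e (a * n) = e a ^ n := by
  rw [e, e, ← Complex.exp_nat_mul]; push_cast; ring_nf

theorem e_eq_one_iff (a : ℝ) : e a = 1 ↔ ∃ z : ℤ, a = z := by
  rw [e, Complex.exp_eq_one_iff]
  refine exists_congr fun z => ?_
  have h : (2 * Real.pi * Complex.I : ℂ) ≠ 0 := Complex.two_pi_I_ne_zero
  rw [mul_comm (2 * Real.pi * Complex.I : ℂ), mul_left_inj' h]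
  exact_mod_cast Iff.rfl

/-- The factor with index `j` and summation variable `m` in the general term of the series. -/
noncomputable def lerchCoeff (lam α : Fin r → ℝ) (s : Fin r → ℂ) (j m : ℕ) : ℂ :=
  e (coord lam j * m) / ((m : ℂ) + (coord α j : ℝ)) ^ coord s j

theorem lerchTerm_eq_prod (lam α : Fin r → ℝ) (s : Fin r → ℂ) (n : Index r) :
    lerchTerm lam α s n = ∏ j : Fin r, lerchCoeff lam α s j (n.1 j) := by
  simp [lerchTerm, lerchCoeff, coord, Finset.prod_div_distrib]

theorem lerchCoeff_eq (lam : Fin r → ℝ) {α : Fin r → ℝ} (hα : ∀ j, α j ∈ Set.Ico (0 : ℝ) 1)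
    (s : Fin r → ℂ) (j : ℕ) {m : ℕ} (hm : 1 ≤ m) :
    lerchCoeff lam α s j m = e (coord lam j) ^ m * (m : ℂ) ^ (-coord s j) *
      (1 + ((coord α j : ℝ) : ℂ) * (m : ℂ)⁻¹) ^ (-coord s j) := by
  rw [lerchCoeff, e_mul_natCast, div_eq_mul_inv, ← Complex.cpow_neg,
    natCast_add_cpow hm (coord_mem_Ico hα j).1, mul_assoc]

/-- The region of convergence of the inner sums over the first `l` variables. -/
def convDomain (r l : ℕ) : Set (Fin r → ℂ) :=
  {s | ∀ i : ℕ, 1 ≤ i → i ≤ l → (i : ℝ) < (partialSum s i).re}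

theorem two_mem_convDomain {l : ℕ} (hl : l ≤ r) : (fun _ => 2 : Fin r → ℂ) ∈ convDomain r l := by
  intro i h1 hi
  have : partialSum (fun _ => 2 : Fin r → ℂ) i = i * 2 := by
    rw [partialSum_eq_sum_coord, Finset.sum_congr rfl (g := fun _ => (2 : ℂ)), Finset.sum_const]
    · simp
    · intro j hj
      have : j < r := (Finset.mem_range.1 hj).trans_le (hi.trans hl)
      simp [coord, this]
  have hi' : (0 : ℝ) < i := by exact_mod_cast h1
  rw [this]
  simp
  linarith

theorem summable_lerchTerm_and_tsum (lam : Fin r → ℝ) {α : Fin r → ℝ}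
    (hα : ∀ j, α j ∈ Set.Ico (0 : ℝ) 1) {s : Fin r → ℂ} (hs : s ∈ convDomain r r) :
    Summable (lerchTerm lam α s) ∧ lerchL lam α s = tailSum (lerchCoeff lam α s) r 0 := by
  have ha : ∀ j < r, ∃ C : ℝ, ∀ m : ℕ, 1 ≤ m →
      ‖lerchCoeff lam α s j m‖ ≤ C * (m : ℝ) ^ (-(coord s j).re) := by
    intro j _
    obtain ⟨C, hC⟩ := (isSymbol_one_add_cpow (differentiable_coord (r := r) j)
      (coord_mem_Ico hα j).1 (coord_mem_Ico hα j).2.le).isBigOOnBall ‖s‖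
    refine ⟨C, fun m hm => ?_⟩
    rw [lerchCoeff_eq lam hα s j hm, norm_mul, norm_mul, norm_pow, norm_e, one_pow, one_mul,
      Complex.norm_natCast_cpow_of_pos (by lia), Complex.neg_re, mul_comm]
    have := hC m hm s le_rfl
    rw [pow_zero, mul_one] at this
    gcongr
  have hσ : ∀ l : ℕ, 1 ≤ l → l ≤ r → (l : ℝ) < ∑ j ∈ Finset.range l, (coord s j).re := by
    intro l h1 hl
    rw [← Complex.re_sum, ← partialSum_eq_sum_coord]
    exact hs l h1 hl
  obtain ⟨h1, -, h2⟩ := summable_prod_and_tsum_eq_tailSum (lerchCoeff lam α s) r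
    (summable_norm_mul_tailSum _ _ r ha hσ) r le_rfl 0
  have hterm : lerchTerm lam α s = fun x : TailIndex r 0 => ∏ j : Fin r, lerchCoeff lam α s j (x.1 j) :=
    funext fun n => lerchTerm_eq_prod lam α s n
  refine ⟨?_, ?_⟩
  · have h3 : Summable fun x : TailIndex r 0 => ‖∏ j : Fin r, lerchCoeff lam α s j (x.1 j)‖ := by
      simpa only [norm_prod] using h1
    rw [hterm]
    exact h3.of_norm
  · rw [lerchL, hterm]
    exact h2

open Classical in
/-- The indices `1 ≤ i ≤ l` for which `λ_1 + ⋯ + λ_i` is an integer. -/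
noncomputable def intIndices (lam : Fin r → ℝ) (l : ℕ) : Finset ℕ :=
  (Finset.Icc 1 l).filter fun i => ∃ z : ℤ, partialSum lam i = z

theorem intIndices_succ_of_mem {lam : Fin r → ℝ} {l : ℕ}
    (h : ∃ z : ℤ, partialSum lam (l + 1) = z) :
    intIndices lam (l + 1) = insert (l + 1) (intIndices lam l) := by
  ext i
  simp only [intIndices, Finset.mem_filter, Finset.mem_Icc, Finset.mem_insert]
  constructor
  · rintro ⟨⟨h1, h2⟩, h3⟩
    rcases Nat.lt_or_ge l i with h4 | h4
    · exact Or.inl (by lia)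
    · exact Or.inr ⟨⟨h1, h4⟩, h3⟩
  · rintro (rfl | ⟨⟨h1, h2⟩, h3⟩)
    · exact ⟨⟨by lia, le_rfl⟩, h⟩
    · exact ⟨⟨h1, by lia⟩, h3⟩

theorem intIndices_succ_of_notMem {lam : Fin r → ℝ} {l : ℕ}
    (h : ¬ ∃ z : ℤ, partialSum lam (l + 1) = z) : intIndices lam (l + 1) = intIndices lam l := by
  ext i
  simp only [intIndices, Finset.mem_filter, Finset.mem_Icc]
  constructor
  · rintro ⟨⟨h1, h2⟩, h3⟩
    have : i ≠ l + 1 := by rintro rfl; exact h h3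
    exact ⟨⟨h1, by lia⟩, h3⟩
  · rintro ⟨⟨h1, h2⟩, h3⟩
    exact ⟨⟨h1, by lia⟩, h3⟩

theorem succ_notMem_intIndices (lam : Fin r → ℝ) (l : ℕ) : l + 1 ∉ intIndices lam l := by
  simp [intIndices]

open Classical in
theorem card_intIndices_le (lam : Fin r → ℝ) (l : ℕ) : (intIndices lam l).card ≤ l :=
  (Finset.card_filter_le (Finset.Icc 1 l) _).trans (by simp)

/-- The entire function of `s` which cancels the poles along the hyperplanes `H_{l,k}`: a reciprocal
Gamma function, and the affine form of `H_{1,0}` for `l = 1`. -/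
noncomputable def polarFactor (lam : Fin r → ℝ) (l : ℕ) (s : Fin r → ℂ) : ℂ :=
  if l = 1 then partialSum s 1 - 1
  else (Complex.Gamma (partialSum s l - (intIndices lam l).card))⁻¹

theorem differentiable_polarFactor (lam : Fin r → ℝ) (l : ℕ) :
    Differentiable ℂ (polarFactor lam l) := by
  by_cases h : l = 1
  · have : polarFactor lam l = fun s => partialSum s 1 - 1 := by
      funext s; simp [polarFactor, h]
    rw [this]
    exact (differentiable_partialSum 1).sub_const 1
  · have : polarFactor lam l =
        fun s => (Complex.Gamma (partialSum s l - (intIndices lam l).card))⁻¹ := by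
      funext s; simp [polarFactor, h]
    rw [this]
    exact Complex.differentiable_one_div_Gamma.comp ((differentiable_partialSum l).sub_const _)

/-- The product of the polar factors of the first `l` indices. -/
noncomputable def polarProd (lam : Fin r → ℝ) (l : ℕ) (s : Fin r → ℂ) : ℂ :=
  ∏ i ∈ intIndices lam l, polarFactor lam i s

theorem differentiable_polarProd (lam : Fin r → ℝ) (l : ℕ) :
    Differentiable ℂ (polarProd lam l) :=
  differentiable_finsetProd _ fun i _ => differentiable_polarFactor lam i

/-- The symbol `G` describes the inner sum over the first `l` variables as a function of the next
summation variable, up to the polar factors. -/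
def IsInnerSumSymbol (lam α : Fin r → ℝ) (l : ℕ) (G : ℕ → (Fin r → ℂ) → ℂ) : Prop :=
  IsSymbol G ∧ ∀ s ∈ convDomain r l, ∀ n : ℕ, 1 ≤ n →
    polarProd lam l s * tailSum (lerchCoeff lam α s) l n =
      e (partialSum lam l) ^ n * (n : ℂ) ^ ((intIndices lam l).card - partialSum s l) * G n s

/-- One summation: `γ` is the polar factor of the index `l + 1` if it is an integer index, and `1`
otherwise; `δ` is `1` or `0` accordingly. -/
theorem IsInnerSumSymbol.succ {lam α : Fin r → ℝ} (hα : ∀ j, α j ∈ Set.Ico (0 : ℝ) 1)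
    {l : ℕ} (hl : l < r) {G : ℕ → (Fin r → ℂ) → ℂ} (hG : IsInnerSumSymbol lam α l G)
    {γ : (Fin r → ℂ) → ℂ} (hγ : Differentiable ℂ γ) {δ : ℕ} (hδ : δ ≤ 1)
    (hprod : ∀ s, polarProd lam (l + 1) s = γ s * polarProd lam l s)
    (hcard : (intIndices lam (l + 1)).card = (intIndices lam l).card + δ)
    (hsol : ∀ R K, IsSolvable (fun s => partialSum s (l + 1) - (intIndices lam l).card) δ
      (e (partialSum lam (l + 1))) R K ((fun _ => γ) *
        ((fun (n : ℕ) (s : Fin r → ℂ) => (1 + ((coord α l : ℝ) : ℂ) * (n : ℂ)⁻¹) ^ (-coord s l)) * G))) :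
    (∃ G', IsInnerSumSymbol lam α (l + 1) G') ∧
      ∃ F : (Fin r → ℂ) → ℂ, Differentiable ℂ F ∧ ∀ s ∈ convDomain r (l + 1),
        polarProd lam (l + 1) s * tailSum (lerchCoeff lam α s) (l + 1) 0 = F s := by
  set W : (Fin r → ℂ) → ℂ := fun s => partialSum s (l + 1) - (intIndices lam l).card with hWdef
  set ζ : ℂ := e (partialSum lam (l + 1)) with hζdef
  set h : ℕ → (Fin r → ℂ) → ℂ := (fun _ => γ) *
    ((fun (n : ℕ) (s : Fin r → ℂ) => (1 + ((coord α l : ℝ) : ℂ) * (n : ℂ)⁻¹) ^ (-coord s l)) * G) with hh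
  have hW : Differentiable ℂ W := (differentiable_partialSum (l + 1)).sub_const _
  have hWre : ∀ s ∈ convDomain r (l + 1), 1 < (W s).re := fun s hs => by
    have h1 := hs (l + 1) (by lia) le_rfl
    have h2 : ((intIndices lam l).card : ℝ) ≤ l := by exact_mod_cast card_intIndices_le lam l
    simp only [hWdef, Complex.sub_re, Complex.natCast_re]
    push_cast at h1
    linarith
  have hhs : IsSymbol h := (isSymbol_of_entire hγ).mul ((isSymbol_one_add_cpow
    (differentiable_coord l) (coord_mem_Ico hα l).1 (coord_mem_Ico hα l).2.le).mul hG.1)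
  have hζ1 : ‖ζ‖ = 1 := norm_e _
  obtain ⟨T, hT, hTs⟩ := exists_isSymbol_tail hW
    ⟨_, hWre _ (two_mem_convDomain (l := l + 1) hl)⟩ hδ hζ1 hhs hsol
  have hterm : ∀ s ∈ convDomain r (l + 1), ∀ m : ℕ, 1 ≤ m → polarProd lam (l + 1) s *
      (lerchCoeff lam α s l m * tailSum (lerchCoeff lam α s) l m) =
      ζ ^ m * (m : ℂ) ^ (-W s) * h m s := fun s hs m hm => by
    have hm0 : (m : ℂ) ≠ 0 := by exact_mod_cast (by lia : m ≠ 0)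
    have h1 := hG.2 s (fun i hi hil => hs i hi (by lia)) m hm
    have h2 : (m : ℂ) ^ (-W s) = (m : ℂ) ^ (-coord s l) *
        (m : ℂ) ^ ((intIndices lam l).card - partialSum s l) := by
      rw [← Complex.cpow_add _ _ hm0]
      simp only [hWdef, partialSum_succ]
      congr 1
      ring
    have h3 : ζ ^ m = e (coord lam l) ^ m * e (partialSum lam l) ^ m := by
      rw [hζdef, partialSum_succ, e_add, mul_pow, mul_comm]
    rw [hprod, lerchCoeff_eq lam hα s l hm, h2, h3]
    simp only [hh, Pi.mul_apply]
    linear_combination (γ s * (e (coord lam l) ^ m * (m : ℂ) ^ (-coord s l) *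
      (1 + ((coord α l : ℝ) : ℂ) * (m : ℂ)⁻¹) ^ (-coord s l))) * h1
  have htail : ∀ s ∈ convDomain r (l + 1), ∀ n, polarProd lam (l + 1) s *
      tailSum (lerchCoeff lam α s) (l + 1) n =
      ∑' k, ζ ^ (n + 1 + k) * ((n + 1 + k : ℕ) : ℂ) ^ (-W s) * h (n + 1 + k) s := fun s hs n => by
    rw [tailSum, ← tsum_mul_left]
    exact tsum_congr fun k => hterm s hs _ (by lia)
  refine ⟨⟨T - (fun (n : ℕ) _ => ((n : ℂ)⁻¹) ^ δ) * h, hT.sub ((isSymbol_inv_pow δ).mul hhs),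
    fun s hs n hn => ?_⟩, fun s => ζ * T 1 s, (hT.differentiable 1 le_rfl).const_mul ζ,
    fun s hs => ?_⟩
  · have h1 := hTs s (hWre s hs) n hn
    have h2 := h1.summable.tsum_eq_zero_add
    rw [h1.tsum_eq] at h2
    have hn0 : (n : ℂ) ≠ 0 := by exact_mod_cast (by lia : n ≠ 0)
    have h3 : (n : ℂ) ^ (δ - W s) * ((n : ℂ)⁻¹) ^ δ = (n : ℂ) ^ (-W s) := by
      rw [inv_pow, ← Complex.cpow_natCast, ← Complex.cpow_neg, ← Complex.cpow_add _ _ hn0]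
      congr 1
      ring
    have h4 : ((intIndices lam (l + 1)).card : ℂ) - partialSum s (l + 1) = δ - W s := by
      rw [hcard, hWdef]; push_cast; ring
    rw [htail s hs n, h4]
    simp only [add_zero, ← add_assoc, add_right_comm n _ 1] at h2
    simp only [Pi.sub_apply, Pi.mul_apply]
    linear_combination (-1 : ℂ) * h2 + ζ ^ n * h n s * h3
  · rw [htail s hs 0]
    have h1 := (hTs s (hWre s hs) 1 le_rfl).tsum_eq
    simpa using h1

/-- The inner sums are described by symbols, and the whole series becomes entire after
multiplication by the polar factors. -/
theorem exists_isInnerSumSymbol (lam : Fin r → ℝ) {α : Fin r → ℝ}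
    (hα : ∀ j, α j ∈ Set.Ico (0 : ℝ) 1) (l : ℕ) : l < r →
    (∃ G', IsInnerSumSymbol lam α (l + 1) G') ∧
      ∃ F : (Fin r → ℂ) → ℂ, Differentiable ℂ F ∧ ∀ s ∈ convDomain r (l + 1),
        polarProd lam (l + 1) s * tailSum (lerchCoeff lam α s) (l + 1) 0 = F s := by
  have hempty : intIndices lam 0 = ∅ := by simp [intIndices]
  have hbase : IsInnerSumSymbol lam α 0 fun _ _ => 1 := by
    refine ⟨isSymbol_of_entire (differentiable_const 1), fun s _ n _ => ?_⟩
    simp [polarProd, hempty, tailSum, partialSum_zero, e_zero]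
  -- the index `l + 1` does not contribute a factor
  have hnonint : ∀ l < r, ∀ G, IsInnerSumSymbol lam α l G →
      (¬ ∃ z : ℤ, partialSum lam (l + 1) = z) →
      (∃ G', IsInnerSumSymbol lam α (l + 1) G') ∧
      ∃ F : (Fin r → ℂ) → ℂ, Differentiable ℂ F ∧ ∀ s ∈ convDomain r (l + 1),
        polarProd lam (l + 1) s * tailSum (lerchCoeff lam α s) (l + 1) 0 = F s := by
    intro l hl G hG hz
    refine hG.succ hα hl (γ := fun _ => 1) (δ := 0) (differentiable_const 1) zero_le_one
      (fun s => by rw [polarProd, intIndices_succ_of_notMem hz, one_mul]; rfl)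
      (by rw [intIndices_succ_of_notMem hz, add_zero]) fun R K => ?_
    refine IsSymbol.isSolvable ((differentiable_partialSum (l + 1)).sub_const _)
      (fun h => hz ((e_eq_one_iff _).1 h)) ?_ R K
    exact (isSymbol_of_entire (differentiable_const 1)).mul ((isSymbol_one_add_cpow
      (differentiable_coord l) (coord_mem_Ico hα l).1 (coord_mem_Ico hα l).2.le).mul hG.1)
  have hint : ∀ l, (∃ z : ℤ, partialSum lam (l + 1) = z) →
      (∀ s, polarProd lam (l + 1) s = polarFactor lam (l + 1) s * polarProd lam l s) ∧
      (intIndices lam (l + 1)).card = (intIndices lam l).card + 1 := fun l hz => by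
    refine ⟨fun s => ?_, ?_⟩
    · rw [polarProd, intIndices_succ_of_mem hz, Finset.prod_insert (succ_notMem_intIndices lam l)]
      rfl
    · rw [intIndices_succ_of_mem hz, Finset.card_insert_of_notMem (succ_notMem_intIndices lam l)]
  induction l with
  | zero =>
    intro hl
    by_cases hz : ∃ z : ℤ, partialSum lam (0 + 1) = z
    · refine hbase.succ hα hl (differentiable_polarFactor lam (0 + 1)) (δ := 1) le_rfl
        (hint 0 hz).1 (hint 0 hz).2 fun R K => ?_
      rw [(e_eq_one_iff _).2 hz]
      refine (isSolvable_shiftedPow ((differentiable_partialSum (0 + 1)).sub_const _)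
        (coord_mem_Ico hα 0).1 (coord_mem_Ico hα 0).2.le R K K 0 (by lia)).congr
          fun n hn s => ?_
      rw [shiftedPow_natCast hn (coord_mem_Ico hα 0).1]
      simp [hempty, polarFactor, partialSum_succ, partialSum_zero]
    · exact hnonint 0 hl _ hbase hz
  | succ l ih =>
    intro hl
    obtain ⟨⟨G, hG⟩, -⟩ := ih (by lia)
    by_cases hz : ∃ z : ℤ, partialSum lam (l + 1 + 1) = z
    · refine hG.succ hα hl (differentiable_polarFactor lam (l + 1 + 1)) (δ := 1) le_rfl
        (hint (l + 1) hz).1 (hint (l + 1) hz).2 fun R K => ?_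
      rw [(e_eq_one_iff _).2 hz]
      have h1 : IsSymbol ((fun (n : ℕ) (s : Fin r → ℂ) =>
          (1 + ((coord α (l + 1) : ℝ) : ℂ) * (n : ℂ)⁻¹) ^ (-coord s (l + 1))) * G) :=
        (isSymbol_one_add_cpow (differentiable_coord (l + 1)) (coord_mem_Ico hα (l + 1)).1
          (coord_mem_Ico hα (l + 1)).2.le).mul hG.1
      refine (h1.isSolvable_inv_Gamma_mul ((differentiable_partialSum (l + 1 + 1)).sub_const
        ((intIndices lam (l + 1)).card : ℂ)) R K).congr fun n _ s => ?_
      simp only [Pi.mul_apply, polarFactor, (hint (l + 1) hz).2]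
      rw [if_neg (by lia)]
      push_cast
      rw [sub_sub]
    · exact hnonint (l + 1) hl G hG hz

end Lerch

/-! ### The polar hyperplanes -/

section Poles

variable {r : ℕ}

/-- The pairs `(l, k)` such that `H_{l,k}` is a zero hyperplane of the polar factor of `l`. -/
def polarSet (lam : Fin r → ℝ) : Set (ℕ × ℕ) :=
  {q | q.1 ∈ intIndices lam r ∧
    if q.1 = 1 then q.2 = 0 else q.1 ≤ q.2 + (intIndices lam q.1).card}

theorem hyperplaneForm_eq_zero_iff (l k : ℕ) (s : Fin r → ℂ) :
    hyperplaneForm l k s = 0 ↔ s ∈ H r l k := by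
  rw [hyperplaneForm, sub_eq_zero]
  rfl

/-- Near a given point a polar factor is a nonvanishing holomorphic function times the affine forms
of the hyperplanes (at most one) that pass through the point. -/
theorem exists_polarFactor_eq (lam : Fin r → ℝ) {l : ℕ} (hl : l ∈ intIndices lam r)
    (p : Fin r → ℂ) : ∃ (t : Finset ℕ) (u : (Fin r → ℂ) → ℂ),
      (∀ k, k ∈ t ↔ (l, k) ∈ polarSet lam ∧ p ∈ H r l k) ∧ Differentiable ℂ u ∧ u p ≠ 0 ∧
      ∀ s, polarFactor lam l s = u s * ∏ k ∈ t, hyperplaneForm l k s := by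
  by_cases h1 : l = 1
  · subst h1
    have hform : ∀ s : Fin r → ℂ, polarFactor lam 1 s = hyperplaneForm 1 0 s := fun s => by
      simp [polarFactor, hyperplaneForm]
    by_cases hp : p ∈ H r 1 0
    · refine ⟨{0}, fun _ => 1, fun k => ?_, differentiable_const 1, one_ne_zero, fun s => ?_⟩
      · simp only [Finset.mem_singleton, polarSet, Set.mem_ofPred_eq, hl, true_and, if_true]
        constructor
        · rintro rfl
          exact ⟨rfl, hp⟩
        · exact fun h => h.1
      · simp [hform]
    · refine ⟨∅, polarFactor lam 1, fun k => ?_, differentiable_polarFactor lam 1, ?_, fun s => ?_⟩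
      · simp only [Finset.notMem_empty, polarSet, Set.mem_ofPred_eq, if_true, false_iff]
        rintro ⟨⟨-, rfl⟩, h⟩
        exact hp h
      · rw [hform]
        exact fun h => hp ((hyperplaneForm_eq_zero_iff 1 0 p).1 h)
      · simp
  · set c := (intIndices lam l).card with hc
    have hcl : c ≤ l := card_intIndices_le lam l
    have hfac : ∀ s : Fin r → ℂ, polarFactor lam l s = (Complex.Gamma (partialSum s l - c))⁻¹ :=
      fun s => by simp [polarFactor, h1, hc]
    have hdiff : Differentiable ℂ fun s : Fin r → ℂ => partialSum s l - c :=
      (differentiable_partialSum l).sub_const _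
    by_cases hp : ∃ k' : ℕ, partialSum p l - c = -(k' : ℂ)
    · obtain ⟨k', hk'⟩ := hp
      have hk : (((l - c + k' : ℕ)) : ℂ) = l - c + k' := by
        push_cast [Nat.cast_sub hcl]; rfl
      refine ⟨{l - c + k'}, fun s => (∏ i ∈ Finset.range k', (partialSum s l - c + i)) *
        (Complex.Gamma (partialSum s l - c + (k' + 1 : ℕ)))⁻¹, fun k => ?_, ?_, ?_, fun s => ?_⟩
      · simp only [Finset.mem_singleton, polarSet, Set.mem_ofPred_eq, hl, true_and, h1, if_false,
          ← hc, H]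
        constructor
        · rintro rfl
          exact ⟨by lia, by rw [hk]; linear_combination hk'⟩
        · rintro ⟨h2, h3⟩
          have : (k : ℂ) = ((l - c + k' : ℕ) : ℂ) := by
            rw [hk]; linear_combination h3 - hk'
          exact_mod_cast this
      · refine Differentiable.mul ?_ (Complex.differentiable_one_div_Gamma.comp (hdiff.add_const _))
        exact differentiable_finsetProd _ fun i _ => hdiff.add_const _
      · refine mul_ne_zero (Finset.prod_ne_zero_iff.2 fun i hi => ?_) ?_
        · rw [hk', neg_add_eq_sub, sub_ne_zero]
          exact_mod_cast (Finset.mem_range.1 hi).ne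
        · rw [hk']
          simp
      · rw [hfac, inv_Gamma_eq_prod_mul _ (k' + 1), Finset.prod_range_succ, Finset.prod_singleton,
          hyperplaneForm, hk]
        ring
    · refine ⟨∅, polarFactor lam l, fun k => ?_, differentiable_polarFactor lam l, ?_, fun s => ?_⟩
      · simp only [Finset.notMem_empty, polarSet, Set.mem_ofPred_eq, h1, if_false, false_iff, ← hc, H]
        rintro ⟨⟨-, h2⟩, h3⟩
        refine hp ⟨k + c - l, ?_⟩
        push_cast [Nat.cast_sub h2]
        rw [h3]
        ring
      · rw [hfac]
        exact inv_ne_zero fun h => hp ((Complex.Gamma_eq_zero_iff _).1 h)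
      · simp

theorem polarFactor_ne_zero {lam : Fin r → ℝ} {l : ℕ} (hl : l ∈ intIndices lam r) {p : Fin r → ℂ}
    (hp : ∀ q ∈ polarSet lam, p ∉ H r q.1 q.2) : polarFactor lam l p ≠ 0 := by
  obtain ⟨t, u, ht, -, hu, he⟩ := exists_polarFactor_eq lam hl p
  have : t = ∅ := Finset.eq_empty_of_forall_notMem fun k hk => hp _ ((ht k).1 hk).1 ((ht k).1 hk).2
  rw [he, this]
  simpa using hu

theorem polarProd_ne_zero {lam : Fin r → ℝ} {p : Fin r → ℂ}
    (hp : ∀ q ∈ polarSet lam, p ∉ H r q.1 q.2) : polarProd lam r p ≠ 0 :=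
  Finset.prod_ne_zero_iff.2 fun _ hl => polarFactor_ne_zero hl hp

/-- The polar hyperplanes do not meet the region of convergence. -/
theorem polarProd_ne_zero_of_mem {lam : Fin r → ℝ} {s : Fin r → ℂ} (hs : s ∈ convDomain r r) :
    polarProd lam r s ≠ 0 := by
  refine polarProd_ne_zero fun q hq h => ?_
  have hq1 := hq.1
  simp only [intIndices, Finset.mem_filter, Finset.mem_Icc] at hq1
  have h1 := hs q.1 hq1.1.1 hq1.1.2
  have h2 : partialSum s q.1 = (q.1 : ℂ) - (q.2 : ℂ) := h
  rw [h2, Complex.sub_re, Complex.natCast_re, Complex.natCast_re] at h1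
  linarith [(Nat.cast_nonneg q.2 : (0 : ℝ) ≤ q.2)]

theorem holomorphicAt_of_differentiable {f : (Fin r → ℂ) → ℂ} (hf : Differentiable ℂ f)
    (p : Fin r → ℂ) : HolomorphicAt f p := Filter.Eventually.of_forall hf

theorem holomorphicAt_div {f g : (Fin r → ℂ) → ℂ} (hf : Differentiable ℂ f)
    (hg : Differentiable ℂ g) {p : Fin r → ℂ} (hp : g p ≠ 0) :
    HolomorphicAt (fun s => f s / g s) p := by
  filter_upwards [hg.continuous.continuousAt.eventually_ne hp] with s hs
  simp only [div_eq_mul_inv]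
  exact (hf s).mul ((differentiableAt_inv hs).comp s (hg s))

theorem isMeromorphic_div_polarProd (lam : Fin r → ℝ) {F : (Fin r → ℂ) → ℂ}
    (hF : Differentiable ℂ F) : IsMeromorphic fun s => F s / polarProd lam r s := by
  refine fun p => ⟨F, polarProd lam r, holomorphicAt_of_differentiable hF p,
    holomorphicAt_of_differentiable (differentiable_polarProd lam r) p, fun h => ?_,
    Filter.Eventually.of_forall fun s _ => rfl⟩
  have := eqOn_of_convex_of_eventuallyEq (f := polarProd lam r) (g := fun _ => 0) isOpen_univ
    convex_univ (differentiable_polarProd lam r).differentiableOn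
    (differentiable_const 0).differentiableOn (Set.mem_univ p) h
  exact polarProd_ne_zero_of_mem (two_mem_convDomain le_rfl)
    (this (Set.mem_univ (fun _ => 2 : Fin r → ℂ)))

theorem hasAtMostSimplePolesAlong_div_polarProd (lam : Fin r → ℝ) {F : (Fin r → ℂ) → ℂ}
    (hF : Differentiable ℂ F) :
    HasAtMostSimplePolesAlong (fun s => F s / polarProd lam r s) (polarSet lam) := by
  refine ⟨fun p hp => holomorphicAt_div hF (differentiable_polarProd lam r)
    (polarProd_ne_zero hp), fun p => ?_⟩
  choose! t u ht hu hu0 he using fun l (hl : l ∈ intIndices lam r) =>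
    exists_polarFactor_eq lam hl p
  set T : Finset (ℕ × ℕ) :=
    (intIndices lam r).biUnion fun l => (t l).image fun k => (l, k) with hTdef
  have hT : ∀ q, q ∈ T ↔ q ∈ polarSet lam ∧ p ∈ H r q.1 q.2 := by
    rintro ⟨l, k⟩
    simp only [hTdef, Finset.mem_biUnion, Finset.mem_image, Prod.mk.injEq]
    constructor
    · rintro ⟨l', hl', k', hk', rfl, rfl⟩
      exact (ht l' hl' k').1 hk'
    · intro h
      exact ⟨l, h.1.1, k, (ht l h.1.1 k).2 h, rfl, rfl⟩
  have hprodT : ∀ s : Fin r → ℂ, ∏ q ∈ T, hyperplaneForm q.1 q.2 s =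
      ∏ l ∈ intIndices lam r, ∏ k ∈ t l, hyperplaneForm l k s := fun s => by
    rw [hTdef, Finset.prod_biUnion]
    · refine Finset.prod_congr rfl fun l _ => Finset.prod_image fun k _ k' _ h => ?_
      simpa using h
    · intro l _ l' _ hll
      rw [Function.onFun, Finset.disjoint_left]
      intro q hq hq'
      obtain ⟨k, -, rfl⟩ := Finset.mem_image.1 hq
      obtain ⟨k', -, h⟩ := Finset.mem_image.1 hq'
      exact hll (congrArg Prod.fst h).symm
  have hdiffu : Differentiable ℂ fun s => ∏ l ∈ intIndices lam r, u l s :=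
    differentiable_finsetProd _ hu
  refine ⟨T, hT, fun s => F s / ∏ l ∈ intIndices lam r, u l s,
    holomorphicAt_div hF hdiffu (Finset.prod_ne_zero_iff.2 hu0),
    Filter.Eventually.of_forall fun s hs => ?_⟩
  have hne : ∏ q ∈ T, hyperplaneForm q.1 q.2 s ≠ 0 := Finset.prod_ne_zero_iff.2 fun q hq h =>
    hs q ((hT q).1 hq).1 ((hyperplaneForm_eq_zero_iff _ _ _).1 h)
  have hpol : polarProd lam r s = (∏ l ∈ intIndices lam r, u l s) *
      ∏ q ∈ T, hyperplaneForm q.1 q.2 s := by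
    rw [hprodT, ← Finset.prod_mul_distrib]
    exact Finset.prod_congr rfl fun l hl => he l hl s
  simp only [hpol]
  rw [div_mul_eq_div_div, div_mul_cancel₀ _ hne]

section Enumeration

variable {lam : Fin r → ℝ} {m : ℕ} {i : ℕ → ℕ}

theorem mem_intIndices_iff_exists
    (himage : i '' Set.Icc 1 m = {l : ℕ | 1 ≤ l ∧ l ≤ r ∧ ∃ z : ℤ, partialSum lam l = (z : ℝ)})
    (l : ℕ) : l ∈ intIndices lam r ↔ ∃ j, 1 ≤ j ∧ j ≤ m ∧ i j = l := by
  have h := Set.ext_iff.1 himage l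
  simp only [Set.mem_image, Set.mem_Icc, Set.mem_ofPred_eq] at h
  simp only [intIndices, Finset.mem_filter, Finset.mem_Icc, and_assoc]
  rw [← h]
  simp only [and_assoc]

theorem card_intIndices_apply (hi : StrictMonoOn i (Set.Icc 1 m))
    (himage : i '' Set.Icc 1 m = {l : ℕ | 1 ≤ l ∧ l ≤ r ∧ ∃ z : ℤ, partialSum lam l = (z : ℝ)})
    {j : ℕ} (hj : 1 ≤ j) (hjm : j ≤ m) : (intIndices lam (i j)).card = j := by
  have hmem := mem_intIndices_iff_exists himage
  have himg : intIndices lam (i j) = (Finset.Icc 1 j).image i := by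
    have hr : i j ≤ r := by
      have := (hmem (i j)).2 ⟨j, hj, hjm, rfl⟩
      simp only [intIndices, Finset.mem_filter, Finset.mem_Icc] at this
      exact this.1.2
    ext l
    have hl : l ∈ intIndices lam (i j) ↔ l ∈ intIndices lam r ∧ l ≤ i j := by
      simp only [intIndices, Finset.mem_filter, Finset.mem_Icc]
      constructor
      · rintro ⟨⟨h1, h2⟩, h3⟩
        exact ⟨⟨⟨h1, h2.trans hr⟩, h3⟩, h2⟩
      · rintro ⟨⟨⟨h1, -⟩, h3⟩, h2⟩
        exact ⟨⟨h1, h2⟩, h3⟩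
    rw [hl, hmem]
    simp only [Finset.mem_image, Finset.mem_Icc]
    constructor
    · rintro ⟨⟨j', h1, h2, rfl⟩, h3⟩
      exact ⟨j', ⟨h1, (hi.le_iff_le ⟨h1, h2⟩ ⟨hj, hjm⟩).1 h3⟩, rfl⟩
    · rintro ⟨j', ⟨h1, h2⟩, rfl⟩
      exact ⟨⟨j', h1, h2.trans hjm, rfl⟩, (hi.le_iff_le ⟨h1, h2.trans hjm⟩ ⟨hj, hjm⟩).2 h2⟩
  rw [himg, Finset.card_image_of_injOn, Nat.card_Icc, Nat.add_sub_cancel]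
  intro a ha b hb hab
  simp only [Finset.coe_Icc, Set.mem_Icc] at ha hb
  exact hi.injOn ⟨ha.1, ha.2.trans hjm⟩ ⟨hb.1, hb.2.trans hjm⟩ hab

theorem apply_eq_one_iff (hi : StrictMonoOn i (Set.Icc 1 m))
    (himage : i '' Set.Icc 1 m = {l : ℕ | 1 ≤ l ∧ l ≤ r ∧ ∃ z : ℤ, partialSum lam l = (z : ℝ)})
    {j : ℕ} (hj : 1 ≤ j) (hjm : j ≤ m) : i j = 1 ↔ j = 1 ∧ i 1 = 1 := by
  constructor
  · intro h
    have h1 := card_intIndices_le lam (i j)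
    rw [card_intIndices_apply hi himage hj hjm, h] at h1
    obtain rfl : j = 1 := by lia
    exact ⟨rfl, h⟩
  · rintro ⟨rfl, h⟩
    exact h

theorem polarSet_eq_of_apply_one (hi : StrictMonoOn i (Set.Icc 1 m))
    (himage : i '' Set.Icc 1 m = {l : ℕ | 1 ≤ l ∧ l ≤ r ∧ ∃ z : ℤ, partialSum lam l = (z : ℝ)})
    (h : 1 ≤ m ∧ i 1 = 1) :
    polarSet lam = {(1, 0)} ∪ {q : ℕ × ℕ | ∃ j : ℕ, 2 ≤ j ∧ j ≤ m ∧ q.1 = i j ∧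
      (i j : ℤ) - (q.2 : ℤ) ≤ (j : ℤ)} := by
  ext ⟨l, k⟩
  simp only [polarSet, Set.mem_ofPred_eq, Set.mem_union, Set.mem_singleton_iff, Prod.mk.injEq,
    mem_intIndices_iff_exists himage]
  constructor
  · rintro ⟨⟨j, h1, h2, rfl⟩, h3⟩
    by_cases hj : j = 1
    · subst hj
      rw [if_pos h.2] at h3
      exact Or.inl ⟨h.2, h3⟩
    · rw [if_neg fun h' => hj ((apply_eq_one_iff hi himage h1 h2).1 h').1,
        card_intIndices_apply hi himage h1 h2] at h3
      exact Or.inr ⟨j, by lia, h2, rfl, by lia⟩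
  · rintro (⟨rfl, rfl⟩ | ⟨j, h1, h2, rfl, h3⟩)
    · exact ⟨⟨1, le_rfl, h.1, h.2⟩, by simp⟩
    · refine ⟨⟨j, by lia, h2, rfl⟩, ?_⟩
      rw [if_neg fun h' => ?_, card_intIndices_apply hi himage (by lia) h2]
      · lia
      · have := ((apply_eq_one_iff hi himage (by lia) h2).1 h').1
        lia

theorem polarSet_eq_of_not_apply_one (hi : StrictMonoOn i (Set.Icc 1 m))
    (himage : i '' Set.Icc 1 m = {l : ℕ | 1 ≤ l ∧ l ≤ r ∧ ∃ z : ℤ, partialSum lam l = (z : ℝ)})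
    (h : ¬ (1 ≤ m ∧ i 1 = 1)) :
    polarSet lam = {q : ℕ × ℕ | ∃ j : ℕ, 1 ≤ j ∧ j ≤ m ∧ q.1 = i j ∧
      (i j : ℤ) - (q.2 : ℤ) ≤ (j : ℤ)} := by
  ext ⟨l, k⟩
  have hne : ∀ j, 1 ≤ j → j ≤ m → i j ≠ 1 := fun j h1 h2 h' =>
    h ⟨h1.trans h2, ((apply_eq_one_iff hi himage h1 h2).1 h').2⟩
  simp only [polarSet, Set.mem_ofPred_eq, mem_intIndices_iff_exists himage]
  constructor
  · rintro ⟨⟨j, h1, h2, rfl⟩, h3⟩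
    rw [if_neg (hne j h1 h2), card_intIndices_apply hi himage h1 h2] at h3
    exact ⟨j, h1, h2, rfl, by lia⟩
  · rintro ⟨j, h1, h2, rfl, h3⟩
    refine ⟨⟨j, h1, h2, rfl⟩, ?_⟩
    rw [if_neg (hne j h1 h2), card_intIndices_apply hi himage h1 h2]
    lia

end Enumeration

end Poles

end MultipleLerch

theorem theorem2 (r : ℕ) (hr : 0 < r) (lam α : Fin r → ℝ)
    (hlam : ∀ j, lam j ∈ Set.Ico (0 : ℝ) 1) (hα : ∀ j, α j ∈ Set.Ico (0 : ℝ) 1)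
    (m : ℕ) (i : ℕ → ℕ) (hi : StrictMonoOn i (Set.Icc 1 m))
    (himage : i '' Set.Icc 1 m =
      {l : ℕ | 1 ≤ l ∧ l ≤ r ∧ ∃ z : ℤ, MultipleLerch.partialSum lam l = (z : ℝ)}) :
    ∃ F : (Fin r → ℂ) → ℂ,
      (∀ s ∈ MultipleLerch.U r,
        Summable (MultipleLerch.lerchTerm lam α s) ∧ F s = MultipleLerch.lerchL lam α s) ∧
      MultipleLerch.IsMeromorphic F ∧
      ((1 ≤ m ∧ i 1 = 1) →
        MultipleLerch.HasAtMostSimplePolesAlong F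
          ({(1, 0)} ∪ {q : ℕ × ℕ | ∃ j : ℕ, 2 ≤ j ∧ j ≤ m ∧ q.1 = i j ∧
            (i j : ℤ) - (q.2 : ℤ) ≤ (j : ℤ)})) ∧
      (¬ (1 ≤ m ∧ i 1 = 1) →
        MultipleLerch.HasAtMostSimplePolesAlong F
          {q : ℕ × ℕ | ∃ j : ℕ, 1 ≤ j ∧ j ≤ m ∧ q.1 = i j ∧
            (i j : ℤ) - (q.2 : ℤ) ≤ (j : ℤ)}) := by
  obtain ⟨l, rfl⟩ : ∃ l, r = l + 1 := ⟨r - 1, by lia⟩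
  obtain ⟨-, F, hF, hFs⟩ := MultipleLerch.exists_isInnerSumSymbol lam hα l (Nat.lt_succ_self l)
  refine ⟨fun s => F s / MultipleLerch.polarProd lam (l + 1) s, fun s hs => ?_,
    MultipleLerch.isMeromorphic_div_polarProd lam hF, fun h => ?_, fun h => ?_⟩
  · obtain ⟨h1, h2⟩ := MultipleLerch.summable_lerchTerm_and_tsum lam hα hs
    refine ⟨h1, ?_⟩
    refine Eq.trans ?_ h2.symm
    simp only [← hFs s hs]
    exact mul_div_cancel_left₀ _ (MultipleLerch.polarProd_ne_zero_of_mem hs)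
  · rw [← MultipleLerch.polarSet_eq_of_apply_one hi himage h]
    exact MultipleLerch.hasAtMostSimplePolesAlong_div_polarProd lam hF
  · rw [← MultipleLerch.polarSet_eq_of_not_apply_one hi himage h]
    exact MultipleLerch.hasAtMostSimplePolesAlong_div_polarProd lam hF
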